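/- A ribbon graph $G=(V,E)$, with $E$ finite, consists of discs called vertices (the elements of $V$) and discs called edges (the elements of $E$) such that vertices and edges intersect in disjoint line segments, each such segment lies on the boundary of exactly one vertex and exactly one edge, and every edge contains exactly two such segments, called its ends; the two remaining segments of the boundary of an edge are called its sides. For $F\subseteq E$ let $(V,F)$ be the ribbon graph obtained from $G$ by deleting the edges that are not in $F$. Let $D(G)=(E,\mathcal{F}(G))$, where $\mathcal{F}(G)$ is the collection of all $F\subseteq E$ such that in each connected component of $G$ the ribbon graph $(V,F)$ has exactly one boundary component. For a set system $D=(E,\mathcal{F})$ and distinct $a,b\in E$ let $D_{ab}=(E,\mathcal{F}_{ab})$, where \[\mathcal{F}_{ab}=\mathcal{F}\bigtriangleup\{X\cup\{a\} \mid X\cup\{b\}\in\mathcal{F}\text{ and }X\subseteq E\setminus\{a,b\}\}.\] Let $a$ and $b$ be distinct edges of $G$ such that an end of $a$ and an end of $b$ are neighbours on the boundary of a vertex, that is, an arc of this boundary that meets no edge in its interior joins an endpoint of this end of $a$ to an endpoint of this end of $b$. Let $G_{ab}$ be the ribbon graph obtained from $G$ by sliding this end of $a$ over $b$: starting at that arc,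 the end of $a$ is moved along the side of $b$ that begins there, without being turned over, until it lies on the boundary of the vertex at the other end of $b$, next to that end. Then \[D(G_{ab})=D(G)_{ab}.\] -/

import Mathlib

open scoped symmDiff

/-! ### Set systems and their handle slides -/

/-- A set system whose ground set is the (finite) type `E`: a collection of subsets of `E`, the
feasible sets. -/
@[ext]
structure SetSystem (E : Type*) where
  /-- The collection `ℱ` of feasible sets. -/
  feasible : Set (Set E)

/-- The set system `D_{ab} = (E, ℱ_{ab})` (used for `a ≠ b`), where
`ℱ_{ab} = ℱ ∆ {X ∪ {a} | X ∪ {b} ∈ ℱ and X ⊆ E \ {a, b}}`. -/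
def SetSystem.handleSlide {E : Type*} (D : SetSystem E) (a b : E) : SetSystem E where
  feasible := D.feasible ∆ {Y | ∃ X : Set E, X ⊆ {a, b}ᶜ ∧ X ∪ {b} ∈ D.feasible ∧ Y = X ∪ {a}}

/-! ### Ribbon graphs

An edge of a ribbon graph is a disc attached to the vertex discs along two disjoint line segments
of its boundary, its two *ends*. The remaining part of its boundary consists of two further
segments, its two *sides*, each of which runs from one end to the other. So it is a rectangle with
four corners. -/

/-- The corners of the edges: `(e, i, s)` is the corner in which the end number `i` of the edge `e`
meets the side number `s` of `e`. Hence the end `i` of `e` is the line segment with endpoints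
`(e, i, false)` and `(e, i, true)`, and the side `s` of `e` is the segment with endpoints
`(e, false, s)` and `(e, true, s)`. -/
abbrev Corner (E : Type*) : Type _ := E × Bool × Bool

/-- The other endpoint of the edge end on which a corner lies. -/
def Corner.acrossEnd {E : Type*} (c : Corner E) : Corner E := (c.1, c.2.1, !c.2.2)

/-- The other endpoint of the edge side on which a corner lies. -/
def Corner.alongSide {E : Type*} (c : Corner E) : Corner E := (c.1, !c.2.1, c.2.2)

/-- Two corners that are consecutive on the boundary circle of a vertex disc: removing the edge
ends from these circles leaves arcs, and `arc` exchanges the two endpoints of every such arc. -/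
inductive VertexStep {E : Type*} (arc : Corner E → Corner E) : Corner E → Corner E → Prop
  | arc (c : Corner E) : VertexStep arc c (arc c)
  | acrossEnd (c : Corner E) : VertexStep arc c c.acrossEnd

/-- A ribbon graph with set of vertices `V` and set of edges `E` (up to homeomorphism respecting
vertices and edges). When the ends of the edges are removed from the boundary circles of the vertex
discs that meet an edge, what is left is a collection of arcs joining the corners of the edges in
pairs; `arc` is this pairing. The boundary circle of a vertex disc that meets an edge is traversed
by passing alternately along an arc and across an edge end; a vertex that is not a value of `vert`
is a disc that meets no edge. -/
structure RibbonGraph (V E : Type*) where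
  /-- The other endpoint of the arc (of the boundary of a vertex) that starts at a corner. -/
  arc : Corner E → Corner E
  arc_involutive : Function.Involutive arc
  arc_ne : ∀ c, arc c ≠ c
  /-- The vertex on whose boundary a corner lies. -/
  vert : Corner E → V
  /-- Two corners lie on the same vertex if and only if they lie on the same boundary circle. -/
  vert_eq_iff : ∀ c d, vert c = vert d ↔ Relation.EqvGen (VertexStep arc) c d

namespace RibbonGraph

variable {V E : Type*}

lemma vert_arc (G : RibbonGraph V E) (c : Corner E) : G.vert (G.arc c) = G.vert c :=
  ((G.vert_eq_iff _ _).2 (.rel _ _ (.arc c))).symm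

lemma vert_acrossEnd (G : RibbonGraph V E) (c : Corner E) :
    G.vert c.acrossEnd = G.vert c :=
  ((G.vert_eq_iff _ _).2 (.rel _ _ (.acrossEnd c))).symm

/-! ### Connected components, boundary components, and the delta-matroid of a ribbon graph -/

/-- The vertices `u` and `v` contain the first and the second end of a common edge. -/
def Joined (G : RibbonGraph V E) (u v : V) : Prop :=
  ∃ e : E, u = G.vert (e, false, false) ∧ v = G.vert (e, true, false)

/-- The connected components of a ribbon graph, as classes of vertices. -/
def ConnComp (G : RibbonGraph V E) : Type _ := Quot G.Joined

/-- Representatives of the boundary components of the spanning ribbon subgraphs of `G`: the corners,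
and the vertices of `G` that meet no edge (the boundary of such a disc contains no corner, and is a
boundary component of every spanning ribbon subgraph). -/
abbrev BoundaryPoint (G : RibbonGraph V E) : Type _ := Corner E ⊕ {v : V // ∀ c, G.vert c ≠ v}

/-- Tracing the boundary of the spanning ribbon subgraph `(V, A)`: from a corner one can move along
an arc of the boundary of a vertex, along the side of an edge that is in `A`, and across the end of
an edge that is not in `A`, since this end then is a piece of the boundary of a vertex along which
nothing is attached. -/
inductive BoundaryStep (G : RibbonGraph V E) (A : Set E) :
    G.BoundaryPoint → G.BoundaryPoint → Prop
  | arc (c : Corner E) : BoundaryStep G A (.inl c) (.inl (G.arc c))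
  | alongSide (c : Corner E) (hc : c.1 ∈ A) : BoundaryStep G A (.inl c) (.inl c.alongSide)
  | acrossEnd (c : Corner E) (hc : c.1 ∉ A) : BoundaryStep G A (.inl c) (.inl c.acrossEnd)

/-- The boundary components of the spanning ribbon subgraph `(V, A)` of `G`. -/
def BoundaryComp (G : RibbonGraph V E) (A : Set E) : Type _ := Quot (G.BoundaryStep A)

/-- A vertex on which a given boundary point lies. -/
def pointVertex (G : RibbonGraph V E) : G.BoundaryPoint → V
  | .inl c => G.vert c
  | .inr v => v.1

/-- The connected component of `G` in which a given boundary component of `(V, A)` lies. -/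
def BoundaryComp.connComp {G : RibbonGraph V E} {A : Set E} :
    G.BoundaryComp A → G.ConnComp :=
  Quot.lift (fun p => Quot.mk _ (G.pointVertex p)) (by
    have hend : ∀ (e : E) (i s : Bool), G.vert (e, i, s) = G.vert (e, i, false) := by
      intro e i s
      cases s
      · rfl
      · exact G.vert_acrossEnd (e, i, false)
    rintro _ _ (c | ⟨c, -⟩ | ⟨c, -⟩)
    · exact congrArg _ (G.vert_arc c).symm
    · obtain ⟨e, i, s⟩ := c
      have key : (Quot.mk G.Joined (G.vert (e, false, false)) : G.ConnComp)
          = Quot.mk _ (G.vert (e, true, false)) := Quot.sound ⟨e, rfl, rfl⟩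
      simp only [pointVertex, Corner.alongSide, hend e _ s]
      cases i
      · exact key
      · exact key.symm
    · exact congrArg _ (G.vert_acrossEnd c).symm)

/-- `A` is the edge set of a spanning quasi-tree of `G`: in every connected component of `G` the
spanning ribbon subgraph `(V, A)` has exactly one boundary component. -/
def IsSpanningQuasiTree (G : RibbonGraph V E) (A : Set E) : Prop :=
  ∀ K : G.ConnComp, ∃! β : G.BoundaryComp A, β.connComp = K

/-- The delta-matroid `D(G)`. -/
def deltaMatroid (G : RibbonGraph V E) : SetSystem E where
  feasible := {A | G.IsSpanningQuasiTree A}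

/-! ### Handle slides of ribbon graphs

Let the end `i` of the edge `a` be next to the end `j` of the edge `b ≠ a` on the boundary of a
vertex, the corner `y = (a, i, s)` of the first being joined to the corner `u = (b, j, t)` of the
second by an arc. Put `x = (a, i, !s)` and `v = (b, !j, t)`. Along the boundary of the vertex and
then along the side `t` of `b` one meets `p, x, y, u, v, q` in this order, where `p = arc x` and
`q = arc v`. Sliding the end of `a` over `b` moves the end with the corners `x`, `y` along the side
of `b` from `u` to `v`, to the arc that starts at `v`: the order becomes `p, u, v, x, y, q`.
So the arcs `p x`, `y u`, `v q` are replaced by the arcs `p u`, `v x`, `y q`. (If `p = v`, so that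
`q = x`, the only thing between the two ends of `b` is the end of `a`, and nothing changes.)
This is the effect of exchanging `x` with `u` and `y` with `v` in the pairing of the corners. -/

open Classical in
/-- The permutation of the corners that exchanges `(a, i, !s)` with `(b, j, t)`, and `(a, i, s)`
with `(b, !j, t)`. -/
noncomputable def slidePerm (a b : E) (i s j t : Bool) : Equiv.Perm (Corner E) :=
  Equiv.swap (a, i, !s) (b, j, t) * Equiv.swap (a, i, s) (b, !j, t)

/-- The pairing of the corners by the arcs of the vertex boundaries after the slide. -/
noncomputable def slideArc (G : RibbonGraph V E) (a b : E) (i s j t : Bool) (c : Corner E) :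
    Corner E :=
  slidePerm a b i s j t (G.arc (slidePerm a b i s j t c))

open Classical in
/-- The vertex on which a corner lies after the slide: the end `i` of `a` has moved to the vertex of
the end `!j` of `b`. -/
noncomputable def slideVert (G : RibbonGraph V E) (a b : E) (i j t : Bool) (c : Corner E) : V :=
  if c.1 = a ∧ c.2.1 = i then G.vert (b, !j, t) else G.vert c

section slide

variable {a b : E} {i s j t : Bool}

open Classical in
lemma slidePerm_apply (hab : a ≠ b) (c : Corner E) :
    slidePerm a b i s j t c =
      if c = (a, i, !s) then (b, j, t) else if c = (b, j, t) then (a, i, !s)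
      else if c = (a, i, s) then (b, !j, t) else if c = (b, !j, t) then (a, i, s) else c := by
  simp only [slidePerm, Equiv.Perm.mul_apply, Equiv.swap_apply_def]
  cases s <;> cases j <;> grind

lemma slidePerm_involutive (hab : a ≠ b) :
    Function.Involutive (slidePerm a b i s j t : Corner E → Corner E) := by
  intro c
  simp only [slidePerm_apply hab]
  cases s <;> cases j <;> grind

/-- The arc at `u` now leads to `p`, unless the end that is moved is alone on its arc. -/
lemma slideArc_u (G : RibbonGraph V E) (hab : a ≠ b) (h : G.arc (a, i, s) = (b, j, t))
    (hp : G.arc (a, i, !s) ≠ (b, !j, t)) :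
    G.slideArc a b i s j t (b, j, t) = G.arc (a, i, !s) := by
  have h' : G.arc (b, j, t) = (a, i, s) := by rw [← h]; exact G.arc_involutive _
  have hne := G.arc_ne (a, i, !s)
  have hinv := G.arc_involutive (a, i, !s)
  simp only [slideArc, slidePerm_apply hab]
  cases s <;> cases j <;> grind

/-- The arc at `v` now leads to `x`. -/
lemma slideArc_v (G : RibbonGraph V E) (hab : a ≠ b) (h : G.arc (a, i, s) = (b, j, t)) :
    G.slideArc a b i s j t (b, !j, t) = (a, i, !s) := by
  simp only [slideArc, slidePerm_apply hab]
  cases s <;> cases j <;> grind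

/-- The arc at `y` now leads to `q`, unless the end that is moved is alone on its arc. -/
lemma slideArc_y (G : RibbonGraph V E) (hab : a ≠ b) (h : G.arc (a, i, s) = (b, j, t))
    (hp : G.arc (a, i, !s) ≠ (b, !j, t)) :
    G.slideArc a b i s j t (a, i, s) = G.arc (b, !j, t) := by
  have h' : G.arc (b, j, t) = (a, i, s) := by rw [← h]; exact G.arc_involutive _
  have hne := G.arc_ne (b, !j, t)
  have hinv := G.arc_involutive (b, !j, t)
  simp only [slideArc, slidePerm_apply hab]
  cases s <;> cases j <;> grind

/-- If the end that is moved is alone between the two ends of `b`, then nothing changes. -/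
lemma slideArc_eq_arc (G : RibbonGraph V E) (hab : a ≠ b) (h : G.arc (a, i, s) = (b, j, t))
    (hp : G.arc (a, i, !s) = (b, !j, t)) : G.slideArc a b i s j t = G.arc := by
  have h' : G.arc (b, j, t) = (a, i, s) := by rw [← h]; exact G.arc_involutive _
  have hp' : G.arc (b, !j, t) = (a, i, !s) := by rw [← hp]; exact G.arc_involutive _
  funext c
  have hinv := G.arc_involutive c
  simp only [slideArc, slidePerm_apply hab]
  cases s <;> cases j <;> grind

/-- All the other arcs stay as they are. -/
lemma slideArc_other (G : RibbonGraph V E) (hab : a ≠ b) (h : G.arc (a, i, s) = (b, j, t))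
    (c : Corner E) (hx : c ≠ (a, i, !s)) (hy : c ≠ (a, i, s)) (hu : c ≠ (b, j, t))
    (hv : c ≠ (b, !j, t)) (hp : c ≠ G.arc (a, i, !s)) (hq : c ≠ G.arc (b, !j, t)) :
    G.slideArc a b i s j t c = G.arc c := by
  have h' : G.arc (b, j, t) = (a, i, s) := by rw [← h]; exact G.arc_involutive _
  have hinv := G.arc_involutive c
  simp only [slideArc, slidePerm_apply hab]
  grind

lemma slideArc_involutive (G : RibbonGraph V E) (hab : a ≠ b) :
    Function.Involutive (G.slideArc a b i s j t) := by
  intro c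
  simp only [slideArc]
  rw [slidePerm_involutive hab, G.arc_involutive, slidePerm_involutive hab]

lemma slideArc_ne (G : RibbonGraph V E) (hab : a ≠ b) (c : Corner E) :
    G.slideArc a b i s j t c ≠ c := by
  intro h
  apply G.arc_ne (slidePerm a b i s j t c)
  have h2 := congrArg (slidePerm a b i s j t) h
  rwa [slideArc, slidePerm_involutive hab] at h2

open Relation in
lemma slideVert_eq_iff (G : RibbonGraph V E) (hab : a ≠ b) (h : G.arc (a, i, s) = (b, j, t))
    (c d : Corner E) :
    G.slideVert a b i j t c = G.slideVert a b i j t d ↔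
      EqvGen (VertexStep (G.slideArc a b i s j t)) c d := by
  classical
  by_cases hp : G.arc (a, i, !s) = (b, !j, t)
  · have hv : G.slideVert a b i j t = G.vert := by
      funext c
      have h1 : G.vert (b, !j, t) = G.vert (a, i, !s) := by rw [← hp]; exact G.vert_arc _
      have h2 : G.vert (a, i, !s) = G.vert (a, i, s) := G.vert_acrossEnd (a, i, s)
      obtain ⟨e, k, r⟩ := c
      unfold slideVert
      split_ifs with hc
      · obtain ⟨rfl, rfl⟩ := hc
        rw [h1]
        cases s <;> cases r <;> simp_all
      · rfl
    rw [slideArc_eq_arc G hab h hp, hv]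
    exact G.vert_eq_iff c d
  have tu := slideArc_u G hab h hp
  have tv := slideArc_v G hab h
  have ty := slideArc_y G hab h hp
  have tother := slideArc_other G hab h
  have tinv := slideArc_involutive (i := i) (s := s) (j := j) (t := t) G hab
  have h' : G.arc (b, j, t) = (a, i, s) := by rw [← h]; exact G.arc_involutive _
  set τ := G.slideArc a b i s j t with hτ
  have eqv := EqvGen.is_equivalence (VertexStep τ)
  have sarc : ∀ c, EqvGen (VertexStep τ) c (τ c) := fun c => .rel _ _ (.arc c)
  have send : ∀ c : Corner E, EqvGen (VertexStep τ) c c.acrossEnd :=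
    fun c => .rel _ _ (.acrossEnd c)
  have hxy : ∀ c : Corner E, (c.1 = a ∧ c.2.1 = i) ↔ (c = (a, i, s) ∨ c = (a, i, !s)) := by
    rintro ⟨e, k, r⟩
    cases s <;> cases r <;> simp
  have rx : EqvGen (VertexStep τ) (b, !j, t) (a, i, !s) := tv ▸ sarc _
  have ry : EqvGen (VertexStep τ) (b, !j, t) (a, i, s) :=
    eqv.trans rx (eqv.symm (send (a, i, s)))
  constructor
  · let f : Corner E → Corner E := fun c => if c.1 = a ∧ c.2.1 = i then (b, j, t) else c
    have hf : ∀ c d, EqvGen (VertexStep G.arc) c d → EqvGen (VertexStep τ) (f c) (f d) := by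
      intro c d hcd
      induction hcd with
      | rel c d hcd =>
        cases hcd with
        | acrossEnd =>
          by_cases hc : c.1 = a ∧ c.2.1 = i
          · simp only [f, Corner.acrossEnd, hc, and_self, if_true]
            exact eqv.refl _
          · simp only [f, Corner.acrossEnd, hc, if_false]
            exact send c
        | arc =>
          have hinv := G.arc_involutive c
          have hxe : f (a, i, !s) = (b, j, t) := by simp [f]
          have hye : f (a, i, s) = (b, j, t) := by simp [f]
          have hfo : ∀ c, c ≠ (a, i, s) → c ≠ (a, i, !s) → f c = c := by
            intro c h1 h2
            simp only [f, hxy, h1, h2, or_self, if_false]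
          have hue : f (b, j, t) = (b, j, t) := by simp [f]
          have hve : f (b, !j, t) = (b, !j, t) := by simp [f, hab.symm]
          have hpy : G.arc (a, i, !s) ≠ (a, i, s) := by
            intro h0
            have := G.arc_involutive (a, i, !s)
            rw [h0, h] at this
            exact hab (congrArg Prod.fst this).symm
          have hqx : G.arc (b, !j, t) ≠ (a, i, !s) := by
            intro h0
            apply hp
            rw [← h0]; exact G.arc_involutive _
          have hqy : G.arc (b, !j, t) ≠ (a, i, s) := by
            intro h0
            have := G.arc_involutive (b, !j, t)
            rw [h0, h] at this
            cases j <;> simp at this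
          have fp := hfo _ hpy (G.arc_ne _)
          have fq := hfo _ hqy hqx
          have sp : EqvGen (VertexStep τ) (b, j, t) (G.arc (a, i, !s)) := tu ▸ sarc _
          have sq : EqvGen (VertexStep τ) (b, !j, t) (G.arc (b, !j, t)) :=
            eqv.trans ry (ty ▸ sarc _)
          by_cases c1 : c = (a, i, !s)
          · rw [c1, hxe, fp]; exact sp
          by_cases c2 : c = (a, i, s)
          · rw [c2, hye, h, hue]; exact eqv.refl _
          by_cases c3 : c = (b, j, t)
          · rw [c3, h', hye, hue]; exact eqv.refl _
          by_cases c4 : c = (b, !j, t)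
          · rw [c4, hve, fq]; exact sq
          by_cases c5 : c = G.arc (a, i, !s)
          · rw [c5, G.arc_involutive, hxe, fp]; exact eqv.symm sp
          by_cases c6 : c = G.arc (b, !j, t)
          · rw [c6, G.arc_involutive, hve, fq]; exact eqv.symm sq
          have c7 : G.arc c ≠ (a, i, s) := by
            intro h0; rw [h0, h] at hinv; exact c3 hinv.symm
          have c8 : G.arc c ≠ (a, i, !s) := by
            intro h0; rw [h0] at hinv; exact c5 hinv.symm
          rw [hfo _ c2 c1, hfo _ c7 c8, ← tother c c1 c2 c3 c4 c5 c6]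
          exact sarc c
      | refl c => exact eqv.refl _
      | symm c d _ ih => exact eqv.symm ih
      | trans c d e _ _ ih1 ih2 => exact eqv.trans ih1 ih2
    have key : ∀ c, ∃ c', EqvGen (VertexStep τ) c c' ∧ f c' = c' ∧
        G.slideVert a b i j t c = G.vert c' := by
      intro c
      by_cases hc : c.1 = a ∧ c.2.1 = i
      · refine ⟨(b, !j, t), ?_, by simp [f, hab.symm], by simp [slideVert, hc]⟩
        rcases (hxy c).1 hc with rfl | rfl
        · exact eqv.symm ry
        · exact eqv.symm rx
      · exact ⟨c, eqv.refl _, by simp only [f, hc, if_false], by simp only [slideVert, hc, if_false]⟩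
    intro hcd
    obtain ⟨c', hc1, hc2, hc3⟩ := key c
    obtain ⟨d', hd1, hd2, hd3⟩ := key d
    rw [hc3, hd3, G.vert_eq_iff] at hcd
    have := hf _ _ hcd
    rw [hc2, hd2] at this
    exact eqv.trans hc1 (eqv.trans this (eqv.symm hd1))
  · intro hcd
    have hx0 : G.slideVert a b i j t (a, i, !s) = G.vert (b, !j, t) := by simp [slideVert]
    have hy0 : G.slideVert a b i j t (a, i, s) = G.vert (b, !j, t) := by simp [slideVert]
    have ho : ∀ c, c ≠ (a, i, s) → c ≠ (a, i, !s) → G.slideVert a b i j t c = G.vert c := by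
      intro c h1 h2
      simp only [slideVert, hxy, h1, h2, or_self, if_false]
    have hvy : G.vert (a, i, !s) = G.vert (a, i, s) := G.vert_acrossEnd (a, i, s)
    have hvu : G.vert (b, j, t) = G.vert (a, i, s) := by rw [← h]; exact G.vert_arc _
    have hu0 : G.slideVert a b i j t (b, j, t) = G.vert (b, j, t) := by
      simp [slideVert, hab.symm]
    have hv0 : G.slideVert a b i j t (b, !j, t) = G.vert (b, !j, t) := by
      simp [slideVert, hab.symm]
    induction hcd with
    | rel c d hcd =>
      cases hcd with
      | acrossEnd =>
        by_cases hc : c.1 = a ∧ c.2.1 = i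
        · simp only [slideVert, Corner.acrossEnd, hc, and_self, if_true]
        · simp only [slideVert, Corner.acrossEnd, hc, if_false]
          exact (G.vert_acrossEnd c).symm
      | arc =>
        have hpy : G.arc (a, i, !s) ≠ (a, i, s) := by
          intro h0
          have := G.arc_involutive (a, i, !s)
          rw [h0, h] at this
          exact hab (congrArg Prod.fst this).symm
        have hqx : G.arc (b, !j, t) ≠ (a, i, !s) := by
          intro h0
          apply hp
          rw [← h0]; exact G.arc_involutive _
        have hqy : G.arc (b, !j, t) ≠ (a, i, s) := by
          intro h0
          have := G.arc_involutive (b, !j, t)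
          rw [h0, h] at this
          cases j <;> simp at this
        have fp := ho _ hpy (G.arc_ne _)
        have fq := ho _ hqy hqx
        rw [G.vert_arc, hvy, ← hvu] at fp
        rw [G.vert_arc] at fq
        by_cases c1 : c = (a, i, !s)
        · rw [c1, ← tv, tinv, hv0, tv, hx0]
        by_cases c2 : c = (a, i, s)
        · rw [c2, ty, hy0, fq]
        by_cases c3 : c = (b, j, t)
        · rw [c3, tu, hu0, fp]
        by_cases c4 : c = (b, !j, t)
        · rw [c4, tv, hv0, hx0]
        by_cases c5 : c = G.arc (a, i, !s)
        · rw [c5, fp, ← tu, tinv, hu0]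
        by_cases c6 : c = G.arc (b, !j, t)
        · rw [c6, fq, ← ty, tinv, hy0]
        have hinv := G.arc_involutive c
        have c7 : G.arc c ≠ (a, i, s) := by
          intro h0; rw [h0, h] at hinv; exact c3 hinv.symm
        have c8 : G.arc c ≠ (a, i, !s) := by
          intro h0; rw [h0] at hinv; exact c5 hinv.symm
        rw [tother c c1 c2 c3 c4 c5 c6, ho _ c2 c1, ho _ c7 c8, G.vert_arc]
    | refl c => rfl
    | symm c d _ ih => exact ih.symm
    | trans c d e _ _ ih1 ih2 => exact ih1.trans ih2

end slide

/-- The ribbon graph `G_{ab}` obtained from `G` by sliding the end `i` of `a` over the edge `b`,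
where the corner `(a, i, s)` of `a` and the corner `(b, j, t)` of `b` are joined by an arc of the
boundary of a vertex. Both directions in which the end of `a` can lie from that of `b` are covered,
as `s` and `t` are arbitrary. -/
noncomputable def handleSlide (G : RibbonGraph V E) {a b : E} (hab : a ≠ b) {i s j t : Bool}
    (h : G.arc (a, i, s) = (b, j, t)) : RibbonGraph V E where
  arc := G.slideArc a b i s j t
  arc_involutive := G.slideArc_involutive hab
  arc_ne := G.slideArc_ne hab
  vert := G.slideVert a b i j t
  vert_eq_iff := G.slideVert_eq_iff hab h

end RibbonGraph

/-! The boundary components of `(V, A)` that contain corners are the orbits of two involutions: the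
pairing by arcs, and the step along an edge, which follows a side if the edge is in `A` and crosses
an end otherwise. By `isSpanningQuasiTree_iff`, `A` is feasible exactly when these orbits are as
large as the connected components allow. A slide conjugates the arc pairing by `slidePerm`. By
`orbitSetoid_conj_iff` one may keep the arcs and conjugate the edge steps instead, so that the
situations before and after the slide differ only at the corners of `a` and `b`.

Cut the boundary at these eight corners. The pieces outside of `a` and `b` pair them up
(`exists_partner`), and one piece is the arc of the slide. The steps along `a` and `b` join the
corners in four pairs. Contracting the path through the arc of the slide (`le_iff_splitOff_le`)
leaves a perfect matching of the six other corners, to be combined with their pairing by the pieces.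
If `a ∉ A` or `b ∈ A`, the matching is the same before and after the slide. If `a ∈ A` and `b ∉ A`,
the six corners split as `p 0, p 1, p 2` and `q 0, q 1, q 2`, and `p k` is matched with `q k` before
the slide, with `q (k + 1)` after it, and with `q (k + 2)` for `A \ {a} ∪ {b}` before it.

The union of two perfect matchings of six points is connected if and only if they are disjoint
(`le_joinPairs_iff`). The three matchings partition the edges of the complete bipartite graph on the
`p k` and `q k`, and a pairing of the six points uses one or three of these edges. With one edge, or
three in the same matching, it avoids exactly two matchings; otherwise it has an edge in each and
avoids none (`PairsUp.parity`). So an even number of the three subgraphs are quasi-trees, which is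
the symmetric difference in `SetSystem.handleSlide`. -/

/-! ### Orbits of two maps -/

/-- The equivalence relation generated by moving along `f` and along `g`. -/
def orbitSetoid {α : Type*} (f g : α → α) : Setoid α :=
  Relation.EqvGen.setoid fun c d => d = f c ∨ d = g c

section orbitSetoid

variable {α : Type*} {f g : α → α}

lemma orbitSetoid_left (c : α) : orbitSetoid f g c (f c) := .rel _ _ (.inl rfl)

lemma orbitSetoid_right (c : α) : orbitSetoid f g c (g c) := .rel _ _ (.inr rfl)

lemma orbitSetoid_le {S : Setoid α} (hf : ∀ c, S c (f c)) (hg : ∀ c, S c (g c)) :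
    orbitSetoid f g ≤ S := by
  refine Setoid.eqvGen_le ?_
  rintro c d (rfl | rfl)
  exacts [hf c, hg c]

/-- Relabelling by `φ` carries the pair `φ f φ`, `g` to the pair `f`, `φ g φ`. This moves the effect
of the slide from the arcs to the edge steps. -/
lemma orbitSetoid_conj_iff {φ : α → α} (hφ : Function.Involutive φ) (c d : α) :
    orbitSetoid (fun c => φ (f (φ c))) g c d ↔
      orbitSetoid f (fun c => φ (g (φ c))) (φ c) (φ d) := by
  constructor
  · intro h
    refine orbitSetoid_le (S := (orbitSetoid f (fun c => φ (g (φ c)))).comap φ) ?_ ?_ h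
    · intro c
      simp only [Setoid.comap_rel, hφ _]
      exact orbitSetoid_left _
    · intro c
      have := orbitSetoid_right (f := f) (g := fun c => φ (g (φ c))) (φ c)
      simpa only [Setoid.comap_rel, hφ _] using this
  · intro h
    have := orbitSetoid_le (S := (orbitSetoid (fun c => φ (f (φ c))) g).comap φ) ?_ ?_ h
    · simpa only [Setoid.comap_rel, hφ _] using this
    · intro c
      have := orbitSetoid_left (f := fun c => φ (f (φ c))) (g := g) (φ c)
      simpa only [Setoid.comap_rel, hφ _] using this
    · intro c
      simp only [Setoid.comap_rel, hφ _]
      exact orbitSetoid_right _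

/-- If `f` is an involution without fixed points and `g` is an involution, then an orbit that
contains a fixed point of `g` contains exactly two of them. -/
lemma exists_partner [Finite α] (hf : Function.Involutive f) (hf' : ∀ c, f c ≠ c)
    (hg : Function.Involutive g) {c : α} (hc : g c = c) :
    ∃ d, d ≠ c ∧ g d = d ∧ orbitSetoid f g c d ∧
      ∀ e, g e = e → orbitSetoid f g c e → e = c ∨ e = d := by
  set F : Equiv.Perm α := hf.toPerm with hF
  set P : Equiv.Perm α := hg.toPerm with hP
  have hFF : F⁻¹ = F := rfl
  have hPP : P⁻¹ = P := rfl
  set h : Equiv.Perm α := P * F with hh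
  -- A product of two involutions is inverted by each of them, so the orbit is that of a dihedral
  -- group. As `g` fixes `c`, it is already the orbit of `c` under the powers of `h`, with `g` and
  -- `f` acting as reflections of the exponent.
  have hinv : P * h * P⁻¹ = h⁻¹ := by
    rw [hh, mul_inv_rev, hFF, ← mul_assoc, mul_assoc P P F]
    nth_rw 1 [← hPP]
    rw [inv_mul_cancel_left]
  have hgk : ∀ k : ℤ, g ((h ^ k) c) = (h ^ (-k)) c := by
    intro k
    have h1 : P * h ^ k * P⁻¹ = h ^ (-k) := by
      rw [← conj_zpow, hinv, inv_zpow']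
    have h2 : (P * h ^ k * P⁻¹) c = g ((h ^ k) c) := by
      have : P⁻¹ c = c := hc
      rw [Equiv.Perm.mul_apply, this, Equiv.Perm.mul_apply]
      rfl
    rw [← h2, h1]
  have hfk : ∀ k : ℤ, f ((h ^ k) c) = (h ^ (-k - 1)) c := by
    intro k
    have h1 : g (f ((h ^ k) c)) = (h ^ (1 + k)) c := by
      rw [zpow_one_add]
      rfl
    rw [← hg (f ((h ^ k) c)), h1, hgk]
    congr 2
    ring
  have horb : ∀ e, orbitSetoid f g c e → ∃ k : ℤ, e = (h ^ k) c := by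
    intro e he
    -- Comparing with the kernel of a predicate expresses that the predicate is constant on orbits.
    have hle : orbitSetoid f g ≤ Setoid.comap (fun e => ∃ k : ℤ, e = (h ^ k) c) ⊥ := by
      refine orbitSetoid_le ?_ ?_ <;> intro e <;> refine propext ⟨?_, ?_⟩
      · rintro ⟨k, rfl⟩
        exact ⟨_, hfk k⟩
      · rintro ⟨k, hk⟩
        exact ⟨_, by rw [← hf e, hk, hfk]⟩
      · rintro ⟨k, rfl⟩
        exact ⟨_, hgk k⟩
      · rintro ⟨k, hk⟩
        exact ⟨_, by rw [← hg e, hk, hgk]⟩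
    have : (∃ k : ℤ, c = (h ^ k) c) = (∃ k : ℤ, e = (h ^ k) c) := hle he
    exact this ▸ ⟨0, rfl⟩
  have horb' : ∀ k : ℕ, orbitSetoid f g c ((h ^ k) c) := by
    intro k
    induction k with
    | zero => exact (orbitSetoid f g).refl _
    | succ k ih =>
      refine (orbitSetoid f g).trans ih ?_
      rw [pow_succ']
      exact (orbitSetoid f g).trans (orbitSetoid_left _) (orbitSetoid_right _)
  set m := Function.minimalPeriod (h • ·) c with hm
  have hper : ∀ k : ℤ, (h ^ k) c = c ↔ (m : ℤ) ∣ k := fun k =>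
    MulAction.zpow_smul_eq_iff_minimalPeriod_dvd (a := h) (b := c)
  have hper2 : ∀ k l : ℤ, (h ^ k) c = (h ^ l) c ↔ (m : ℤ) ∣ k - l := by
    intro k l
    rw [← hper, sub_eq_neg_add, zpow_add, Equiv.Perm.mul_apply, zpow_neg, Equiv.Perm.inv_eq_iff_eq]
  have hmpos : 0 < m := by
    obtain ⟨n, hn, hn'⟩ := isOfFinOrder_iff_pow_eq_one.1 (isOfFinOrder_of_finite h)
    rcases Nat.eq_zero_or_pos m with h0 | h0
    · have := (hper n).1 (by rw [zpow_natCast, hn']; rfl)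
      rw [h0] at this
      simp at this
      omega
    · exact h0
  -- If `m = 2 * k + 1`, the reflection `f` of the exponent would fix `(h ^ k) c`.
  have hmeven : Even m := by
    by_contra hodd
    obtain ⟨k, hk⟩ := Nat.not_even_iff_odd.1 hodd
    refine hf' ((h ^ (k : ℤ)) c) ?_
    rw [hfk, hper2]
    exact ⟨-1, by rw [hk]; push_cast; ring⟩
  obtain ⟨n, hn⟩ := hmeven
  -- The partner is the antipode of `c`: `g` fixes `(h ^ k) c` if and only if `m = 2 * n` divides `2
  -- * k`, so `k` is a multiple of `n`.
  refine ⟨(h ^ n) c, ?_, ?_, horb' n, ?_⟩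
  · intro h0
    rw [← zpow_natCast, hper, hn] at h0
    have := Int.le_of_dvd (by omega) h0
    omega
  · rw [← zpow_natCast, hgk, hper2]
    exact ⟨-1, by rw [hn]; push_cast; ring⟩
  · intro e he hce
    obtain ⟨k, rfl⟩ := horb e hce
    rw [hgk, hper2] at he
    obtain ⟨l, hl⟩ := he
    rw [← zpow_natCast, hper, hper2]
    have hk : k = -(n * l) := by
      rw [hn] at hl
      push_cast at hl
      linarith
    rcases Int.even_or_odd l with ⟨r, hr⟩ | ⟨r, hr⟩
    · exact .inl ⟨-r, by rw [hk, hr, hn]; push_cast; ring⟩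
    · exact .inr ⟨-r - 1, by rw [hk, hr, hn]; push_cast; ring⟩

end orbitSetoid

/-! ### Joining points in pairs -/

/-- The equivalence relation generated by `R` and the pairs `p i`, `q i`. -/
def joinPairs {α ι : Type*} (R : Setoid α) (p q : ι → α) : Setoid α :=
  R ⊔ Relation.EqvGen.setoid fun c d => ∃ i, c = p i ∧ d = q i

section joinPairs

variable {α ι : Type*} {R S K : Setoid α}

section

variable {p q : ι → α}

lemma le_joinPairs : R ≤ joinPairs R p q := le_sup_left

lemma joinPairs_rel (i : ι) : joinPairs R p q (p i) (q i) :=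
  (le_sup_right : _ ≤ joinPairs R p q) (.rel _ _ ⟨i, rfl, rfl⟩)

lemma joinPairs_le (h : R ≤ S) (h' : ∀ i, S (p i) (q i)) : joinPairs R p q ≤ S := by
  refine sup_le h (Setoid.eqvGen_le ?_)
  rintro c d ⟨i, rfl, rfl⟩
  exact h' i

lemma joinPairs_le_iff : joinPairs R p q ≤ S ↔ R ≤ S ∧ ∀ i, S (p i) (q i) :=
  ⟨fun h => ⟨le_joinPairs.trans h, fun i => h (joinPairs_rel i)⟩, fun h => joinPairs_le h.1 h.2⟩

/-- The equivalence relation `R` pairs up the members of `P`. -/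
def PairsUp (R : Setoid α) (P : Set α) : Prop :=
  ∀ c ∈ P, ∃ d ∈ P, d ≠ c ∧ R c d ∧ ∀ e ∈ P, R c e → e = c ∨ e = d

/-- Two related points are related by `R`, or both are related to points of `P`. -/
def RelatedThrough (R : Setoid α) (P : Set α) (K : Setoid α) : Prop :=
  ∀ c d, K c d → R c d ∨ ((∃ e ∈ P, R c e) ∧ ∃ e ∈ P, R d e)

/-- Joining only merges classes that meet `P`. The condition depends on the set of joined points and
not on how they are matched, so it is common to the three matchings. -/
lemma relatedThrough_joinPairs : RelatedThrough R (Set.range p ∪ Set.range q) (joinPairs R p q) := by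
  set P := Set.range p ∪ Set.range q
  let S : Setoid α :=
    { r := fun c d => R c d ∨ ((∃ e ∈ P, R c e) ∧ ∃ e ∈ P, R d e)
      iseqv :=
        { refl := fun c => .inl (R.refl c)
          symm := by
            rintro c d (h | ⟨h, h'⟩)
            exacts [.inl (R.symm h), .inr ⟨h', h⟩]
          trans := by
            rintro c d e (h | ⟨h, h'⟩) (k | ⟨k, k'⟩)
            · exact .inl (R.trans h k)
            · obtain ⟨r, hr, hdr⟩ := k
              exact .inr ⟨⟨r, hr, R.trans h hdr⟩, k'⟩
            · obtain ⟨r, hr, hdr⟩ := h'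
              exact .inr ⟨h, ⟨r, hr, R.trans (R.symm k) hdr⟩⟩
            · exact .inr ⟨h, k'⟩ } }
  have : joinPairs R p q ≤ S := by
    refine joinPairs_le (fun c d h => .inl h) fun i => .inr ⟨⟨p i, ?_, R.refl _⟩, q i, ?_, R.refl _⟩
    · exact .inl ⟨i, rfl⟩
    · exact .inr ⟨i, rfl⟩
  exact fun c d h => this h

end

variable {p q : Fin 3 → α}

/-- Joining six paired up points in pairs connects all of them if and only if no pair is joined to
itself. -/
lemma le_joinPairs_iff (hR : PairsUp R (Set.range p ∪ Set.range q))
    (hd : (Sum.elim p q).Injective) (hK : ∀ c ∈ Set.range p ∪ Set.range q, K (p 0) c) :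
    K ≤ joinPairs R p q ↔
      RelatedThrough R (Set.range p ∪ Set.range q) K ∧ ∀ i, ¬ R (p i) (q i) := by
  have hpq : ∀ i k, p i ≠ q k := fun i k h => by simpa using @hd (.inl i) (.inr k) h
  have hpp : ∀ i k, p i = p k → i = k := fun i k h => by simpa using @hd (.inl i) (.inl k) h
  have hqq : ∀ i k, q i = q k → i = k := fun i k h => by simpa using @hd (.inr i) (.inr k) h
  constructor
  · intro h
    refine ⟨fun c d hcd => relatedThrough_joinPairs c d (h hcd), fun i hi => ?_⟩
    -- If `p i` and `q i` are already partners, their class contains no other joined point, so it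
    -- stays a class of `joinPairs R p q` and never reaches `p k`.
    have huniq : ∀ e ∈ Set.range p ∪ Set.range q, R (p i) e → e = p i ∨ e = q i := by
      obtain ⟨d, -, -, -, hu⟩ := hR (p i) (.inl ⟨i, rfl⟩)
      have := hu (q i) (.inr ⟨i, rfl⟩) hi
      rcases this with h1 | h1
      · exact (hpq _ _ h1.symm).elim
      · rwa [h1]
    have hle : joinPairs R p q ≤ Setoid.comap (fun e => R (p i) e) ⊥ := by
      refine joinPairs_le ?_ ?_
      · intro c d hcd
        exact propext ⟨fun h => R.trans h hcd, fun h => R.trans h (R.symm hcd)⟩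
      · intro k
        by_cases hk : k = i
        · subst hk
          exact propext ⟨fun _ => hi, fun _ => R.refl _⟩
        · refine propext ⟨fun h => ?_, fun h => ?_⟩
          · rcases huniq _ (.inl ⟨k, rfl⟩) h with h1 | h1
            · exact (hk (hpp _ _ h1)).elim
            · exact (hpq _ _ h1).elim
          · rcases huniq _ (.inr ⟨k, rfl⟩) h with h1 | h1
            · exact (hpq _ _ h1.symm).elim
            · exact (hk (hqq _ _ h1)).elim
    obtain ⟨k, hk⟩ : ∃ k : Fin 3, k ≠ i := exists_ne i
    have h1 : joinPairs R p q (p i) (p k) :=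
      h (K.trans (K.symm (hK _ (.inl ⟨i, rfl⟩))) (hK _ (.inl ⟨k, rfl⟩)))
    have h2 : R (p i) (p i) = R (p i) (p k) := hle h1
    rcases huniq _ (.inl ⟨k, rfl⟩) (h2 ▸ R.refl _) with h3 | h3
    · exact hk (hpp _ _ h3)
    · exact hpq _ _ h3
  · rintro ⟨hC, hn⟩
    set B := joinPairs R p q with hB
    have hRB : ∀ {c d}, R c d → B c d := fun h => le_joinPairs h
    have hpB : ∀ i, B (p i) (q i) := joinPairs_rel
    -- The partner of `p i` is not `q i`, so it lies in another of the three pairs. Three pairs,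
    -- each linked to another one, are all linked.
    have hlink : ∀ i k l : Fin 3, i ≠ k → i ≠ l → k ≠ l → B (p i) (p k) ∨ B (p i) (p l) := by
      intro i k l hik hil hkl
      obtain ⟨d, hdP, hdne, hid, -⟩ := hR (p i) (.inl ⟨i, rfl⟩)
      have hcase : ∀ r : Fin 3, r = i ∨ r = k ∨ r = l := by omega
      rcases hdP with ⟨r, rfl⟩ | ⟨r, rfl⟩ <;> rcases hcase r with rfl | rfl | rfl
      · exact (hdne rfl).elim
      · exact .inl (hRB hid)
      · exact .inr (hRB hid)
      · exact (hn _ hid).elim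
      · exact .inl (B.trans (hRB hid) (B.symm (hpB _)))
      · exact .inr (B.trans (hRB hid) (B.symm (hpB _)))
    have h01 := hlink 0 1 2 (by decide) (by decide) (by decide)
    have h12 := hlink 1 0 2 (by decide) (by decide) (by decide)
    have h20 := hlink 2 0 1 (by decide) (by decide) (by decide)
    have hall : ∀ i, B (p 0) (p i) := by
      have h1 : B (p 0) (p 1) ∧ B (p 0) (p 2) := by
        have hs : ∀ i k, B (p i) (p k) → B (p k) (p i) := fun _ _ h => B.symm h
        have ht : ∀ i k l, B (p i) (p k) → B (p k) (p l) → B (p i) (p l) :=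
          fun _ _ _ h h' => B.trans h h'
        grind
      intro i
      fin_cases i
      exacts [B.refl _, h1.1, h1.2]
    have hallP : ∀ c ∈ Set.range p ∪ Set.range q, B (p 0) c := by
      rintro _ (⟨i, rfl⟩ | ⟨i, rfl⟩)
      exacts [hall i, B.trans (hall i) (hpB i)]
    intro c d hcd
    rcases hC c d hcd with h | ⟨⟨e, he, hce⟩, e', he', hde⟩
    · exact hRB h
    · exact B.trans (hRB hce) (B.trans (B.symm (hallP e he))
        (B.trans (hallP e' he') (B.symm (hRB hde))))

/-- A cyclic shift of `q` changes neither its range nor the distinctness of the six points. -/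
lemma le_joinPairs_add_iff (hR : PairsUp R (Set.range p ∪ Set.range q))
    (hd : (Sum.elim p q).Injective) (hK : ∀ c ∈ Set.range p ∪ Set.range q, K (p 0) c)
    (k : Fin 3) :
    K ≤ joinPairs R p (fun i => q (i + k)) ↔
      RelatedThrough R (Set.range p ∪ Set.range q) K ∧ ∀ i, ¬ R (p i) (q (i + k)) := by
  have hrange : Set.range (fun i => q (i + k)) = Set.range q :=
    (Equiv.addRight k).surjective.range_comp q
  have hd' : (Sum.elim p fun i => q (i + k)).Injective := by
    have : (Sum.elim p fun i => q (i + k)) = Sum.elim p q ∘ Sum.map id (Equiv.addRight k) := by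
      ext (i | i) <;> rfl
    rw [this]
    exact hd.comp (Function.injective_id.sumMap (Equiv.addRight k).injective)
  rw [← hrange] at hR hK ⊢
  exact le_joinPairs_iff hR hd' hK

set_option synthInstance.maxSize 1000 in
set_option synthInstance.maxHeartbeats 200000 in
/-- The nine pairs with one point among the `p i` and one among the `q i` fall into three perfect
matchings. A pairing of the six points meets an odd number of them. -/
lemma PairsUp.parity (hR : PairsUp R (Set.range p ∪ Set.range q))
    (hd : (Sum.elim p q).Injective) :
    (∀ i, ¬ R (p i) (q (i + 1))) ↔
      Xor (∀ i, ¬ R (p i) (q i)) (∀ i, ¬ R (p i) (q (i + 2))) := by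
  -- The pairing becomes a fixed-point-free involution `f` of the six indices, which makes the
  -- parity statement a finite check.
  obtain ⟨f, hf⟩ : ∃ f : Fin 3 ⊕ Fin 3 → Fin 3 ⊕ Fin 3, ∀ c, f c ≠ c ∧
      ∀ d, d ≠ c → (R (Sum.elim p q c) (Sum.elim p q d) ↔ d = f c) := by
    have hP : ∀ c, Sum.elim p q c ∈ Set.range p ∪ Set.range q := by
      rintro (i | i)
      exacts [.inl ⟨i, rfl⟩, .inr ⟨i, rfl⟩]
    have hP' : ∀ c ∈ Set.range p ∪ Set.range q, ∃ d, Sum.elim p q d = c := by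
      rintro _ (⟨i, rfl⟩ | ⟨i, rfl⟩)
      exacts [⟨.inl i, rfl⟩, ⟨.inr i, rfl⟩]
    have : ∀ c, ∃ e, e ≠ c ∧ ∀ d, d ≠ c → (R (Sum.elim p q c) (Sum.elim p q d) ↔ d = e) := by
      intro c
      obtain ⟨d, hd1, hd2, hd3, hd4⟩ := hR _ (hP c)
      obtain ⟨e, rfl⟩ := hP' d hd1
      refine ⟨e, fun h => hd2 (h ▸ rfl), fun d hdc => ⟨fun h => ?_, fun h => h ▸ hd3⟩⟩
      rcases hd4 _ (hP d) h with h1 | h1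
      exacts [(hdc (hd h1)).elim, hd h1]
    choose f hf using this
    exact ⟨f, hf⟩
  have hinv : ∀ c, f (f c) = c := by
    intro c
    have h := (hf c).1
    exact (((hf (f c)).2 c h.symm).1 (R.symm (((hf c).2 _ h).2 rfl))).symm
  have hpf : ∀ i k, R (p i) (q k) ↔ .inr k = f (.inl i) := fun i k => (hf (.inl i)).2 (.inr k) (by simp)
  -- Here `a`, `b`, `c` stand for the values of `f` at `.inl 0`, `.inl 1`, `.inl 2`; only these
  -- decide which pairs between the two sides occur.
  have key : ∀ a b c : Fin 3 ⊕ Fin 3, a ≠ .inl 0 → b ≠ .inl 1 → c ≠ .inl 2 →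
      a ≠ b → a ≠ c → b ≠ c → (a = .inl 1 ↔ b = .inl 0) → (a = .inl 2 ↔ c = .inl 0) →
      (b = .inl 2 ↔ c = .inl 1) →
      ((.inr 1 ≠ a ∧ .inr 2 ≠ b ∧ .inr 0 ≠ c) ↔ ((.inr 0 ≠ a ∧ .inr 1 ≠ b ∧ .inr 2 ≠ c) ↔
        ¬ (.inr 2 ≠ a ∧ .inr 0 ≠ b ∧ .inr 1 ≠ c))) := by
    set_option maxRecDepth 10000 in decide
  have hinj : Function.Injective f := Function.LeftInverse.injective hinv
  have hswap : ∀ c d, f c = d ↔ f d = c := fun c d =>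
    ⟨fun h => h ▸ hinv c, fun h => h ▸ hinv d⟩
  have := key (f (.inl 0)) (f (.inl 1)) (f (.inl 2)) (hf _).1 (hf _).1 (hf _).1
    (hinj.ne (by decide)) (hinj.ne (by decide)) (hinj.ne (by decide)) (hswap _ _) (hswap _ _)
    (hswap _ _)
  have h3 : ∀ P : Fin 3 → Prop, (∀ i, P i) ↔ P 0 ∧ P 1 ∧ P 2 := fun P =>
    ⟨fun h => ⟨h 0, h 1, h 2⟩, fun h i => by fin_cases i; exacts [h.1, h.2.1, h.2.2]⟩
  simp only [hpf, xor_iff_iff_not, h3]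
  exact this

/-- Join six paired up points along the three perfect matchings. The number of times that all of
them become connected is even. -/
lemma PairsUp.le_joinPairs_iff_xor (hR : PairsUp R (Set.range p ∪ Set.range q))
    (hd : (Sum.elim p q).Injective) (hK : ∀ c ∈ Set.range p ∪ Set.range q, K (p 0) c) :
    K ≤ joinPairs R p (fun i => q (i + 1)) ↔
      Xor (K ≤ joinPairs R p q) (K ≤ joinPairs R p (fun i => q (i + 2))) := by
  rw [le_joinPairs_add_iff hR hd hK, le_joinPairs_add_iff hR hd hK, le_joinPairs_iff hR hd hK,
    hR.parity hd, xor_iff_iff_not, xor_iff_iff_not]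
  by_cases hC : RelatedThrough R (Set.range p ∪ Set.range q) K <;> simp only [hC] <;> tauto

end joinPairs

/-! ### Steps between the corners of an edge -/

lemma Corner.acrossEnd_acrossEnd {E : Type*} (c : Corner E) : c.acrossEnd.acrossEnd = c := by
  simp [Corner.acrossEnd]

lemma Corner.alongSide_alongSide {E : Type*} (c : Corner E) : c.alongSide.alongSide = c := by
  simp [Corner.alongSide]

open Classical in
/-- The other end of the piece of the boundary of an edge that lies on the boundary of the spanning
ribbon subgraph with edge set `A`. -/
noncomputable def edgeStep {E : Type*} (A : Set E) (c : Corner E) : Corner E :=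
  if c.1 ∈ A then c.alongSide else c.acrossEnd

namespace RibbonGraph

variable {V E : Type*}

/-! ### Connectivity of corners -/

/-- Two corners lie in the same connected component. -/
def connSetoid (G : RibbonGraph V E) : Setoid (Corner E) :=
  Setoid.comap (fun c => (Quot.mk _ (G.vert c) : G.ConnComp)) ⊥

/-- Two corners lie on the same boundary component of the spanning ribbon subgraph `(V, A)`. -/
noncomputable def boundarySetoid (G : RibbonGraph V E) (A : Set E) : Setoid (Corner E) :=
  orbitSetoid G.arc (edgeStep A)

lemma connSetoid_arc (G : RibbonGraph V E) (c : Corner E) : G.connSetoid c (G.arc c) :=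
  congrArg _ (G.vert_arc c).symm

lemma connSetoid_acrossEnd (G : RibbonGraph V E) (c : Corner E) : G.connSetoid c c.acrossEnd :=
  congrArg _ (G.vert_acrossEnd c).symm

lemma connSetoid_alongSide (G : RibbonGraph V E) (c : Corner E) : G.connSetoid c c.alongSide :=
  congrArg BoundaryComp.connComp
    -- With `A = Set.univ` every side belongs to the boundary, so well-definedness of
    -- `BoundaryComp.connComp` applies to each of them.
    (Quot.sound (BoundaryStep.alongSide (G := G) (A := Set.univ) c (Set.mem_univ _)))

lemma connSetoid_same_edge (G : RibbonGraph V E) (e : E) (k l : Bool × Bool) :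
    G.connSetoid (e, k) (e, l) := by
  have h1 : ∀ k l m, G.connSetoid (e, k, l) (e, k, m) := by
    intro k l m
    by_cases h : l = m
    · subst h; exact G.connSetoid.refl _
    · obtain rfl : m = !l := by cases l <;> cases m <;> simp_all
      exact G.connSetoid_acrossEnd (e, k, l)
  have h2 : ∀ k l m, G.connSetoid (e, k, m) (e, l, m) := by
    intro k l m
    by_cases h : k = l
    · subst h; exact G.connSetoid.refl _
    · obtain rfl : l = !k := by cases k <;> cases l <;> simp_all
      exact G.connSetoid_alongSide (e, k, m)
  exact G.connSetoid.trans (h1 _ _ l.2) (h2 _ _ _)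

lemma boundarySetoid_le_connSetoid (G : RibbonGraph V E) (A : Set E) :
    G.boundarySetoid A ≤ G.connSetoid := by
  refine orbitSetoid_le G.connSetoid_arc fun c => ?_
  unfold edgeStep
  split_ifs
  exacts [G.connSetoid_alongSide c, G.connSetoid_acrossEnd c]

/-- An equivalence relation on the corners that relates the endpoints of the arcs, and the corners
of every edge, relates all the corners in a connected component. -/
lemma connSetoid_le (G : RibbonGraph V E) {S : Setoid (Corner E)} (harc : ∀ c, S c (G.arc c))
    (hedge : ∀ e k l, S (e, k) (e, l)) : G.connSetoid ≤ S := by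
  have hvert : ∀ c d, G.vert c = G.vert d → S c d := by
    intro c d h
    have : Relation.EqvGen.setoid (VertexStep G.arc) ≤ S := by
      refine Setoid.eqvGen_le ?_
      rintro c _ (_ | _)
      exacts [harc c, hedge _ _ _]
    exact this ((G.vert_eq_iff c d).1 h)
  intro c d hcd
  -- The union of the `S`-classes that meet `v` is the same for joined vertices, so it descends to
  -- connected components.
  let f : V → Set (Corner E) := fun v => {d | ∃ c, G.vert c = v ∧ S c d}
  have hf : ∀ u v, G.Joined u v → f u = f v := by
    rintro _ _ ⟨e, rfl, rfl⟩
    ext d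
    constructor
    · rintro ⟨c, hc, hcd⟩
      exact ⟨_, rfl, S.trans (hedge e _ _) (S.trans (hvert _ _ hc.symm) hcd)⟩
    · rintro ⟨c, hc, hcd⟩
      exact ⟨_, rfl, S.trans (hedge e _ _) (S.trans (hvert _ _ hc.symm) hcd)⟩
  have h : f (G.vert c) = f (G.vert d) := congrArg (Quot.lift f hf) hcd
  obtain ⟨c', hc', hcd'⟩ : d ∈ f (G.vert c) := h ▸ ⟨d, rfl, S.refl _⟩
  exact S.trans (hvert _ _ hc'.symm) hcd'

/-- A vertex that meets no edge is alone in its connected component. -/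
lemma eq_of_connComp_eq (G : RibbonGraph V E) {v w : V} (hv : ∀ c, G.vert c ≠ v)
    (h : (Quot.mk _ w : G.ConnComp) = Quot.mk _ v) : w = v := by
  have hf : ∀ u u', G.Joined u u' → (u = v) = (u' = v) := by
    rintro _ _ ⟨e, rfl, rfl⟩
    simp [hv]
  have h' : (w = v) = (v = v) := congrArg (Quot.lift (· = v) hf) h
  simpa using h'

lemma boundaryComp_mk_eq_iff (G : RibbonGraph V E) (A : Set E) (c d : Corner E) :
    (Quot.mk _ (.inl c) : G.BoundaryComp A) = Quot.mk _ (.inl d) ↔ G.boundarySetoid A c d := by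
  constructor
  · intro h
    let f : G.BoundaryPoint → Option (Quotient (G.boundarySetoid A)) :=
      Sum.elim (fun c => some (Quotient.mk _ c)) fun _ => none
    have hf : ∀ p q, G.BoundaryStep A p q → f p = f q := by
      rintro _ _ (c | ⟨c, hc⟩ | ⟨c, hc⟩)
      · exact congrArg some (Quotient.sound (orbitSetoid_left c))
      · refine congrArg some (Quotient.sound ?_)
        have := orbitSetoid_right (f := G.arc) (g := edgeStep A) c
        rwa [edgeStep, if_pos hc] at this
      · refine congrArg some (Quotient.sound ?_)
        have := orbitSetoid_right (f := G.arc) (g := edgeStep A) c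
        rwa [edgeStep, if_neg hc] at this
    have h' : f (.inl c) = f (.inl d) := congrArg (Quot.lift f hf) h
    exact Quotient.exact (Option.some.inj h')
  · intro h
    have : G.boundarySetoid A ≤
        Setoid.comap (fun c => (Quot.mk _ (.inl c) : G.BoundaryComp A)) ⊥ := by
      refine orbitSetoid_le (fun c => Quot.sound (.arc c)) fun c => Quot.sound ?_
      unfold edgeStep
      split_ifs with hc
      exacts [.alongSide c hc, .acrossEnd c hc]
    exact this h

/-- A vertex without edges is a whole component with a single boundary component, so only the
components that contain corners impose a condition. -/
lemma isSpanningQuasiTree_iff (G : RibbonGraph V E) (A : Set E) :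
    G.IsSpanningQuasiTree A ↔ G.connSetoid ≤ G.boundarySetoid A := by
  constructor
  · intro h c d hcd
    rw [← boundaryComp_mk_eq_iff]
    exact (h (Quot.mk _ (G.vert c))).unique rfl (Eq.symm hcd)
  · rintro h ⟨v⟩
    by_cases hv : ∀ c, G.vert c ≠ v
    · refine ⟨Quot.mk _ (.inr ⟨v, hv⟩), rfl, ?_⟩
      rintro ⟨c | w⟩ hw
      · exact (hv c (G.eq_of_connComp_eq hv hw)).elim
      · have : w = ⟨v, hv⟩ := Subtype.ext (G.eq_of_connComp_eq hv hw)
        rw [this]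
    · push Not at hv
      obtain ⟨c, rfl⟩ := hv
      refine ⟨Quot.mk _ (.inl c), rfl, ?_⟩
      rintro ⟨d | w⟩ hw
      · exact (G.boundaryComp_mk_eq_iff A d c).2 (h hw)
      · exact (w.2 c (G.eq_of_connComp_eq w.2 (Eq.symm hw))).elim

/-! ### The effect of a slide -/

section slide

variable {a b : E} {i s j t : Bool}

/-- The corners `c` and `slidePerm a b i s j t c` lie on the same edge, or on `a` and `b`. -/
lemma slidePerm_rel (hab : a ≠ b) {S : Setoid (Corner E)} (hedge : ∀ e k l, S (e, k) (e, l))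
    {k l : Bool × Bool} (h : S (a, k) (b, l)) (c : Corner E) :
    S c (slidePerm a b i s j t c) := by
  have hab' : ∀ k l, S (a, k) (b, l) := fun _ _ => S.trans (hedge _ _ _) (S.trans h (hedge _ _ _))
  rw [slidePerm_apply hab]
  split_ifs with h1 h2 h3 h4
  · rw [h1]; exact hab' _ _
  · rw [h2]; exact S.symm (hab' _ _)
  · rw [h3]; exact hab' _ _
  · rw [h4]; exact S.symm (hab' _ _)
  · exact S.refl _

lemma handleSlide_connSetoid (G : RibbonGraph V E) (hab : a ≠ b)
    (h : G.arc (a, i, s) = (b, j, t)) : (G.handleSlide hab h).connSetoid = G.connSetoid := by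
  refine le_antisymm (connSetoid_le _ (fun c => ?_) G.connSetoid_same_edge)
    (connSetoid_le _ (fun c => ?_) (G.handleSlide hab h).connSetoid_same_edge)
  · have hφ := slidePerm_rel (i := i) (s := s) (j := j) (t := t) hab G.connSetoid_same_edge
      (h ▸ G.connSetoid_arc (a, i, s))
    exact G.connSetoid.trans (hφ c) (G.connSetoid.trans (G.connSetoid_arc _) (hφ _))
  · set G' := G.handleSlide hab h with hG'
    -- The moved end of `a` now shares an arc with the other end of `b`, so `a` and `b` remain in
    -- one component.
    have hva : G'.connSetoid (a, i, !s) (b, !j, t) := by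
      have : G'.arc (b, !j, t) = (a, i, !s) := G.slideArc_v hab h
      exact G'.connSetoid.symm (this ▸ G'.connSetoid_arc (b, !j, t))
    have hφ := slidePerm_rel (i := i) (s := s) (j := j) (t := t) hab G'.connSetoid_same_edge hva
    have harc : G'.arc (slidePerm a b i s j t c) = slidePerm a b i s j t (G.arc c) := by
      change G.slideArc a b i s j t _ = _
      rw [slideArc, slidePerm_involutive hab]
    refine G'.connSetoid.trans (hφ c) (G'.connSetoid.trans (G'.connSetoid_arc _) ?_)
    rw [harc]
    exact G'.connSetoid.symm (hφ _)

/-- What the step along an edge of the ribbon graph after the slide becomes if the corners are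
exchanged by `slidePerm`. -/
noncomputable def slideEdgeStep (a b : E) (i s j t : Bool) (A : Set E) (c : Corner E) : Corner E :=
  slidePerm a b i s j t (edgeStep A (slidePerm a b i s j t c))

lemma handleSlide_feasible_iff (G : RibbonGraph V E) (hab : a ≠ b)
    (h : G.arc (a, i, s) = (b, j, t)) (A : Set E) :
    (G.handleSlide hab h).IsSpanningQuasiTree A ↔
      G.connSetoid ≤ orbitSetoid G.arc (slideEdgeStep a b i s j t A) := by
  have hφ := slidePerm_rel (i := i) (s := s) (j := j) (t := t) hab G.connSetoid_same_edge
    (h ▸ G.connSetoid_arc (a, i, s))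
  have hinv := slidePerm_involutive (i := i) (s := s) (j := j) (t := t) hab
  have hK : ∀ {c d}, G.connSetoid c d →
      G.connSetoid (slidePerm a b i s j t c) (slidePerm a b i s j t d) := fun hcd =>
    G.connSetoid.trans (G.connSetoid.symm (hφ _)) (G.connSetoid.trans hcd (hφ _))
  have hB : ∀ c d, (G.handleSlide hab h).boundarySetoid A c d ↔
      orbitSetoid G.arc (slideEdgeStep a b i s j t A) (slidePerm a b i s j t c)
        (slidePerm a b i s j t d) := orbitSetoid_conj_iff hinv
  rw [isSpanningQuasiTree_iff, handleSlide_connSetoid]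
  constructor
  · intro hle c d hcd
    have := (hB _ _).1 (hle (hK hcd))
    rwa [hinv, hinv] at this
  · intro hle c d hcd
    exact (hB _ _).2 (hle (hK hcd))

end slide

end RibbonGraph

/-! ### Orbits as joined pieces, and contraction of a path -/

/-- Here `g` is `τ` with some of its transpositions switched off; restoring these joins their
endpoints. -/
lemma orbitSetoid_eq_joinPairs {α ι : Type*} {f g τ : α → α} {p q : ι → α}
    (hp : ∀ k, τ (p k) = q k) (hq : ∀ k, τ (q k) = p k)
    (h : ∀ c, (g c = c ∧ ∃ k, c = p k ∨ c = q k) ∨ g c = τ c) :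
    orbitSetoid f τ = joinPairs (orbitSetoid f g) p q := by
  refine le_antisymm (orbitSetoid_le (fun c => le_joinPairs (orbitSetoid_left c)) fun c => ?_)
    (joinPairs_le (orbitSetoid_le orbitSetoid_left fun c => ?_) fun k => ?_)
  · rcases h c with ⟨-, k, rfl | rfl⟩ | hc
    · rw [hp]; exact joinPairs_rel k
    · rw [hq]; exact (joinPairs _ _ _).symm (joinPairs_rel k)
    · rw [← hc]; exact le_joinPairs (orbitSetoid_right c)
  · rcases h c with ⟨hc, -⟩ | hc
    · rw [hc]
    · rw [hc]; exact orbitSetoid_right c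
  · rw [← hp]; exact orbitSetoid_right _

lemma setoid_comm {α : Type*} (S : Setoid α) (x y : α) : S x y ↔ S y x := S.comm'

/-- The equivalence relation `K` with the points `y` and `u` split off. -/
def splitOff {α : Type*} (K : Setoid α) (y u : α) : Setoid α where
  r c d := K c d ∧ ((c = y ∨ c = u) ↔ (d = y ∨ d = u))
  iseqv :=
    { refl := fun c => ⟨K.refl c, Iff.rfl⟩
      symm := fun h => ⟨K.symm h.1, h.2.symm⟩
      trans := fun h h' => ⟨K.trans h.1 h'.1, h.2.trans h'.2⟩ }

/-- Replacing a path through `m`, `y`, `u`, `n` by a pair `m`, `n`. -/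
lemma le_iff_splitOff_le {α : Type*} {R K T J : Setoid α} {y u m n c d c' d' : α}
    (hT : ∀ S : Setoid α, T ≤ S ↔ R ≤ S ∧ S m y ∧ S u n ∧ S c d ∧ S c' d')
    (hJ : ∀ S : Setoid α, J ≤ S ↔ R ≤ S ∧ S m n ∧ S c d ∧ S c' d')
    (hyu : R y u) (hR : ∀ c d, R c d → ((c = y ∨ c = u) ↔ (d = y ∨ d = u))) (hTK : T ≤ K)
    (hne : ∀ e ∈ ({m, n, c, d, c', d'} : Set α), ¬ (e = y ∨ e = u)) :
    K ≤ T ↔ splitOff K y u ≤ J := by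
  classical
  obtain ⟨hRT, hmy, hun, hcd, hcd'⟩ := (hT T).1 le_rfl
  obtain ⟨hRJ, hmn, hcdJ, hcdJ'⟩ := (hJ J).1 le_rfl
  have hTmn : T m n := T.trans hmy (T.trans (hRT hyu) hun)
  have hJT : J ≤ T := (hJ T).2 ⟨hRT, hTmn, hcd, hcd'⟩
  -- The contraction moves `y` and `u` to the end `m` of the path. Every point is `T`-related to its
  -- image, and `r` carries `T` into `J`.
  let r : α → α := fun e => if e = y ∨ e = u then m else e
  have hr : ∀ e ∈ ({m, n, c, d, c', d'} : Set α), r e = e := fun e he => if_neg (hne e he)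
  have hTr : T ≤ J.comap r := by
    refine (hT _).2 ⟨fun e f hef => ?_, ?_, ?_, ?_, ?_⟩ <;> simp only [Setoid.comap_rel]
    · by_cases he : e = y ∨ e = u
      · rw [show r e = m from if_pos he, show r f = m from if_pos ((hR e f hef).1 he)]
      · rw [show r e = e from if_neg he,
          show r f = f from if_neg fun hf => he ((hR e f hef).2 hf)]
        exact hRJ hef
    · rw [hr m (by simp), show r y = m from if_pos (.inl rfl)]
    · rw [hr n (by simp), show r u = m from if_pos (.inr rfl)]
      exact hmn
    · rwa [hr c (by simp), hr d (by simp)]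
    · rwa [hr c' (by simp), hr d' (by simp)]
  have hrT : ∀ e, T e (r e) := by
    intro e
    by_cases he : e = y ∨ e = u
    · rw [show r e = m from if_pos he]
      rcases he with rfl | rfl
      exacts [T.symm hmy, T.symm (T.trans hmy (hRT hyu))]
    · rw [show r e = e from if_neg he]
  have hr' : ∀ e, ¬ (r e = y ∨ r e = u) := by
    intro e
    by_cases he : e = y ∨ e = u
    · rw [show r e = m from if_pos he]
      exact hne m (by simp)
    · rwa [show r e = e from if_neg he]
  constructor
  · rintro hK e f ⟨hef, hiff⟩
    by_cases he : e = y ∨ e = u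
    · rcases he with rfl | rfl <;> rcases hiff.1 (by simp) with rfl | rfl
      exacts [J.refl _, hRJ hyu, J.symm (hRJ hyu), J.refl _]
    · have := hTr (hK hef)
      rwa [Setoid.comap_rel, show r e = e from if_neg he,
        show r f = f from if_neg fun hf => he (hiff.2 hf)] at this
  · intro hK e f hef
    have hef' : K (r e) (r f) := K.trans (K.symm (hTK (hrT e))) (K.trans hef (hTK (hrT f)))
    exact T.trans (hrT e) (T.trans (hJT (hK ⟨hef', iff_of_false (hr' e) (hr' f)⟩))
      (T.symm (hrT f)))

/-! ### Edge steps with and without `a` and `b` -/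

section edgeStep

variable {E : Type*} {A : Set E}

lemma edgeStep_of_mem {c : Corner E} (h : c.1 ∈ A) : edgeStep A c = c.alongSide := if_pos h

lemma edgeStep_of_notMem {c : Corner E} (h : c.1 ∉ A) : edgeStep A c = c.acrossEnd := if_neg h

lemma edgeStep_fst (c : Corner E) : (edgeStep A c).1 = c.1 := by
  unfold edgeStep; split_ifs <;> rfl

lemma edgeStep_involutive : Function.Involutive (edgeStep A) := by
  intro c
  by_cases h : c.1 ∈ A
  · rw [edgeStep_of_mem h, edgeStep_of_mem (by exact h), Corner.alongSide_alongSide]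
  · rw [edgeStep_of_notMem h, edgeStep_of_notMem (by exact h), Corner.acrossEnd_acrossEnd]

lemma edgeStep_ne (c : Corner E) : edgeStep A c ≠ c := by
  obtain ⟨e, k, l⟩ := c
  unfold edgeStep
  split_ifs <;> simp [Corner.alongSide, Corner.acrossEnd]

open Classical in
/-- The step along the edges other than `a` and `b`. -/
noncomputable def restStep (a b : E) (A : Set E) (c : Corner E) : Corner E :=
  if c.1 = a ∨ c.1 = b then c else edgeStep A c

variable {a b : E}

lemma restStep_involutive : Function.Involutive (restStep a b A) := by
  intro c
  by_cases h : c.1 = a ∨ c.1 = b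
  · simp [restStep, h]
  · have h' : ¬ ((edgeStep A c).1 = a ∨ (edgeStep A c).1 = b) := by rwa [edgeStep_fst]
    rw [restStep, restStep, if_neg h, if_neg h', edgeStep_involutive]

lemma restStep_eq_self_iff {c : Corner E} : restStep a b A c = c ↔ c.1 = a ∨ c.1 = b := by
  unfold restStep
  split_ifs with h
  · simp [h]
  · simp [h, edgeStep_ne]

lemma restStep_congr {B : Set E} (h : ∀ e, e ≠ a → e ≠ b → (e ∈ A ↔ e ∈ B)) :
    restStep a b A = restStep a b B := by
  funext c
  unfold restStep
  split_ifs with hc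
  · rfl
  · push Not at hc
    by_cases hB : c.1 ∈ B <;> simp [edgeStep, hB, h c.1 hc.1 hc.2]

end edgeStep

/-! ### Cutting the boundary at the corners of `a` and `b` -/

namespace RibbonGraph

variable {V E : Type*}

section slide

variable {a b : E} {i s j t : Bool}

/-- Two corners are related if they lie on the same piece of boundary outside of `a` and `b`. -/
noncomputable def restSetoid (G : RibbonGraph V E) (a b : E) (A : Set E) : Setoid (Corner E) :=
  orbitSetoid G.arc (restStep a b A)

lemma slidePerm_x (hab : a ≠ b) : slidePerm a b i s j t (a, i, !s) = (b, j, t) := by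
  simp [slidePerm_apply hab]

lemma slidePerm_u (hab : a ≠ b) : slidePerm a b i s j t (b, j, t) = (a, i, !s) := by
  simp [slidePerm_apply hab, hab.symm]

lemma slidePerm_y (hab : a ≠ b) : slidePerm a b i s j t (a, i, s) = (b, !j, t) := by
  simp [slidePerm_apply hab, hab]

lemma slidePerm_v (hab : a ≠ b) : slidePerm a b i s j t (b, !j, t) = (a, i, s) := by
  simp [slidePerm_apply hab, hab.symm]

lemma slidePerm_far_a (hab : a ≠ b) (l : Bool) :
    slidePerm a b i s j t (a, !i, l) = (a, !i, l) := by
  simp [slidePerm_apply hab, hab]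

lemma slidePerm_far_b (hab : a ≠ b) (k : Bool) :
    slidePerm a b i s j t (b, k, !t) = (b, k, !t) := by
  simp [slidePerm_apply hab, hab.symm]

lemma slidePerm_other (hab : a ≠ b) {c : Corner E} (h : ¬ (c.1 = a ∨ c.1 = b)) :
    slidePerm a b i s j t c = c := by
  rw [slidePerm_apply hab, if_neg, if_neg, if_neg, if_neg] <;> rintro rfl <;> simp at h

/-- The boundary components before the slide, in terms of the pieces outside of `a` and `b`. -/
lemma boundarySetoid_eq_joinPairs (G : RibbonGraph V E) {A : Set E} {p q : Fin 4 → Corner E}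
    (hp : ∀ k, edgeStep A (p k) = q k)
    (hcover : ∀ c : Corner E, c.1 = a ∨ c.1 = b → ∃ k, c = p k ∨ c = q k) :
    G.boundarySetoid A = joinPairs (G.restSetoid a b A) p q := by
  refine orbitSetoid_eq_joinPairs hp (fun k => by rw [← hp, edgeStep_involutive]) fun c => ?_
  by_cases hc : c.1 = a ∨ c.1 = b
  · exact .inl ⟨if_pos hc, hcover c hc⟩
  · exact .inr (if_neg hc)

/-- The boundary components after the slide, in terms of the pieces outside of `a` and `b`. -/
lemma slideSetoid_eq_joinPairs (G : RibbonGraph V E) (hab : a ≠ b) {A : Set E}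
    {p q : Fin 4 → Corner E}
    (hp : ∀ k, edgeStep A (p k) = q k)
    (hcover : ∀ c : Corner E, c.1 = a ∨ c.1 = b → ∃ k, c = p k ∨ c = q k) :
    orbitSetoid G.arc (slideEdgeStep a b i s j t A) = joinPairs (G.restSetoid a b A)
      (slidePerm a b i s j t ∘ p) (slidePerm a b i s j t ∘ q) := by
  have hφ := slidePerm_involutive (i := i) (s := s) (j := j) (t := t) hab
  refine orbitSetoid_eq_joinPairs (fun k => ?_) (fun k => ?_) fun c => ?_
  · simp only [Function.comp, slideEdgeStep, hφ _, hp]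
  · simp only [Function.comp, slideEdgeStep, hφ _, ← hp, edgeStep_involutive _]
  by_cases hc : c.1 = a ∨ c.1 = b
  · refine .inl ⟨if_pos hc, ?_⟩
    have hc' : (slidePerm a b i s j t c).1 = a ∨ (slidePerm a b i s j t c).1 = b := by
      by_contra hn
      have := slidePerm_other (i := i) (s := s) (j := j) (t := t) hab hn
      rw [hφ] at this
      exact hn (this ▸ hc)
    obtain ⟨k, hk⟩ := hcover _ hc'
    refine ⟨k, hk.imp ?_ ?_⟩ <;> intro hk <;> rw [Function.comp, ← hk, hφ]
  · refine .inr ?_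
    have hc' : ¬ ((edgeStep A c).1 = a ∨ (edgeStep A c).1 = b) := by rwa [edgeStep_fst]
    rw [restStep, if_neg hc, slideEdgeStep, slidePerm_other hab hc, slidePerm_other hab hc']

lemma forall_fin_four {P : Fin 4 → Prop} (h0 : P 0) (h1 : P 1) (h2 : P 2) (h3 : P 3) (k : Fin 4) :
    P k := by
  fin_cases k <;> assumption

lemma corner_cases (i s j t : Bool) {c : Corner E} (h : c.1 = a ∨ c.1 = b) :
    (c = (a, i, !s) ∨ c = (a, i, s) ∨ c = (a, !i, !s) ∨ c = (a, !i, s)) ∨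
      (c = (b, j, t) ∨ c = (b, !j, t) ∨ c = (b, j, !t) ∨ c = (b, !j, !t)) := by
  obtain ⟨e, k, l⟩ := c
  rcases h with h | h <;> obtain rfl : e = _ := h
  · left
    revert i s k l
    simp only [Prod.mk.injEq, true_and]
    decide
  · right
    revert j t k l
    simp only [Prod.mk.injEq, true_and]
    decide

/-- Four pairs that make up all the corners of `a` and `b`. -/
def edgePairs (a b : E) (i s j t : Bool) (α β : Bool) : Fin 4 → Corner E × Corner E :=
  ![((a, i, !s), if α then (a, !i, !s) else (a, i, s)),
    if α then ((a, i, s), (a, !i, s)) else ((a, !i, !s), (a, !i, s)),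
    ((b, j, t), if β then (b, !j, t) else (b, j, !t)),
    if β then ((b, j, !t), (b, !j, !t)) else ((b, !j, t), (b, !j, !t))]

lemma edgePairs_spec {A : Set E} {α β : Bool} (hα : a ∈ A ↔ α) (hβ : b ∈ A ↔ β) :
    (∀ k, edgeStep A (edgePairs a b i s j t α β k).1 = (edgePairs a b i s j t α β k).2) ∧
      ∀ c : Corner E, c.1 = a ∨ c.1 = b →
        ∃ k, c = (edgePairs a b i s j t α β k).1 ∨ c = (edgePairs a b i s j t α β k).2 := by
  refine ⟨?_, ?_⟩
  · apply forall_fin_four <;> cases α <;> cases β <;>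
      simp [edgePairs, edgeStep, hα, hβ, Corner.alongSide, Corner.acrossEnd]
  · intro c hc
    rcases corner_cases i s j t hc with (h | h | h | h) | (h | h | h | h) <;> cases α <;> cases β <;>
      first
        | exact ⟨0, .inl h⟩ | exact ⟨0, .inr h⟩ | exact ⟨1, .inl h⟩ | exact ⟨1, .inr h⟩
        | exact ⟨2, .inl h⟩ | exact ⟨2, .inr h⟩ | exact ⟨3, .inl h⟩ | exact ⟨3, .inr h⟩

/-- The boundary components before and after the slide, in terms of the pieces outside of `a` and
`b`. -/
lemma setoids_eq_joinPairs (G : RibbonGraph V E) (hab : a ≠ b) {A : Set E} {α β : Bool}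
    (hα : a ∈ A ↔ α) (hβ : b ∈ A ↔ β) :
    G.boundarySetoid A = joinPairs (G.restSetoid a b A)
        (fun k => (edgePairs a b i s j t α β k).1) (fun k => (edgePairs a b i s j t α β k).2) ∧
      orbitSetoid G.arc (slideEdgeStep a b i s j t A) = joinPairs (G.restSetoid a b A)
        (fun k => slidePerm a b i s j t (edgePairs a b i s j t α β k).1)
        (fun k => slidePerm a b i s j t (edgePairs a b i s j t α β k).2) := by
  obtain ⟨hp, hc⟩ := edgePairs_spec (i := i) (s := s) (j := j) (t := t) hα hβ
  exact ⟨boundarySetoid_eq_joinPairs G hp hc, slideSetoid_eq_joinPairs G hab hp hc⟩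

lemma forall_fin_four_iff {P : Fin 4 → Prop} : (∀ k, P k) ↔ P 0 ∧ P 1 ∧ P 2 ∧ P 3 :=
  ⟨fun h => ⟨h 0, h 1, h 2, h 3⟩, fun h => forall_fin_four h.1 h.2.1 h.2.2.1 h.2.2.2⟩

/-- Testing against all `S` makes the order of the pairs, and of the points in a pair, a matter of
propositional logic. -/
lemma setoids_le_iff (G : RibbonGraph V E) (hab : a ≠ b) (A : Set E) {α β : Bool}
    (hα : a ∈ A ↔ α) (hβ : b ∈ A ↔ β) (S : Setoid (Corner E)) :
    (G.boundarySetoid A ≤ S ↔ G.restSetoid a b A ≤ S ∧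
        ∀ k, S (edgePairs a b i s j t α β k).1 (edgePairs a b i s j t α β k).2) ∧
      (orbitSetoid G.arc (slideEdgeStep a b i s j t A) ≤ S ↔ G.restSetoid a b A ≤ S ∧
        ∀ k, S (slidePerm a b i s j t (edgePairs a b i s j t α β k).1)
          (slidePerm a b i s j t (edgePairs a b i s j t α β k).2)) := by
  obtain ⟨h1, h2⟩ := setoids_eq_joinPairs (i := i) (s := s) (j := j) (t := t) G hab hα hβ
  rw [h1, h2]
  exact ⟨joinPairs_le_iff, joinPairs_le_iff⟩

/-- The two ends of the arc of the slide are exchanged by `arc` and fixed by `restStep`, so they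
form a class of their own. -/
lemma restSetoid_iff (G : RibbonGraph V E) (h : G.arc (a, i, s) = (b, j, t)) (A : Set E)
    (c d : Corner E) (hcd : G.restSetoid a b A c d) :
    (c = (a, i, s) ∨ c = (b, j, t)) ↔ (d = (a, i, s) ∨ d = (b, j, t)) := by
  have h' : G.arc (b, j, t) = (a, i, s) := by rw [← h]; exact G.arc_involutive _
  have hy : restStep a b A (a, i, s) = (a, i, s) := if_pos (.inl rfl)
  have hu : restStep a b A (b, j, t) = (b, j, t) := if_pos (.inr rfl)
  have harc : ∀ c, c = (a, i, s) ∨ c = (b, j, t) → G.arc c = (a, i, s) ∨ G.arc c = (b, j, t) := by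
    rintro _ (rfl | rfl)
    exacts [.inr h, .inl h']
  have hrest : ∀ c, c = (a, i, s) ∨ c = (b, j, t) →
      restStep a b A c = (a, i, s) ∨ restStep a b A c = (b, j, t) := by
    rintro _ (rfl | rfl)
    exacts [.inl hy, .inr hu]
  have hle : G.restSetoid a b A ≤
      Setoid.comap (fun c => c = (a, i, s) ∨ c = (b, j, t)) ⊥ := by
    refine orbitSetoid_le (fun c => propext ⟨harc c, fun hc => ?_⟩)
      (fun c => propext ⟨hrest c, fun hc => ?_⟩)
    · have := harc _ hc
      rwa [G.arc_involutive] at this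
    · have := hrest _ hc
      rwa [restStep_involutive] at this
  exact iff_of_eq (hle hcd)

lemma slideSetoid_le_connSetoid (G : RibbonGraph V E) (hab : a ≠ b)
    (h : G.arc (a, i, s) = (b, j, t)) (A : Set E) :
    orbitSetoid G.arc (slideEdgeStep a b i s j t A) ≤ G.connSetoid := by
  have hφ := slidePerm_rel (i := i) (s := s) (j := j) (t := t) hab G.connSetoid_same_edge
    (h ▸ G.connSetoid_arc (a, i, s))
  refine orbitSetoid_le G.connSetoid_arc fun c => ?_
  have hA : ∀ c, G.connSetoid c (edgeStep A c) := fun c =>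
    G.boundarySetoid_le_connSetoid A (orbitSetoid_right c)
  exact G.connSetoid.trans (hφ c) (G.connSetoid.trans (hA _) (hφ _))

lemma forall_fin_three_iff {P : Fin 3 → Prop} : (∀ k, P k) ↔ P 0 ∧ P 1 ∧ P 2 :=
  ⟨fun h => ⟨h 0, h 1, h 2⟩, fun h k => by fin_cases k; exacts [h.1, h.2.1, h.2.2]⟩

/-- If the class of boundary points that contains the arc of the slide leads from `m` to `n`,
then this arc can be left out. -/
lemma connSetoid_le_iff (G : RibbonGraph V E) (h : G.arc (a, i, s) = (b, j, t)) (A : Set E)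
    {T : Setoid (Corner E)} (hTK : T ≤ G.connSetoid) (p q : Fin 3 → Corner E)
    (m n c d c' d' : Corner E)
    (hT : ∀ S : Setoid (Corner E), T ≤ S ↔ G.restSetoid a b A ≤ S ∧
      S m (a, i, s) ∧ S (b, j, t) n ∧ S c d ∧ S c' d')
    (hpq : ∀ S : Setoid (Corner E), (S (p 0) (q 0) ∧ S (p 1) (q 1) ∧ S (p 2) (q 2)) ↔
      S m n ∧ S c d ∧ S c' d')
    (hne : ∀ e ∈ ({m, n, c, d, c', d'} : Set (Corner E)), ¬ (e = (a, i, s) ∨ e = (b, j, t))) :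
    G.connSetoid ≤ T ↔ splitOff G.connSetoid (a, i, s) (b, j, t) ≤
      joinPairs (G.restSetoid a b A) p q :=
  le_iff_splitOff_le hT (fun S => by rw [joinPairs_le_iff, forall_fin_three_iff, hpq])
    (h ▸ orbitSetoid_left (a, i, s)) (restSetoid_iff G h A) hTK hne

/-! ### The sets on which the slide has no effect -/

/-- If `a` is not in `A`, or `b` is in `A`, then the slide does not change whether `(V, A)` is a
spanning quasi-tree. -/
lemma handleSlide_feasible_iff_of_notMem_or_mem (G : RibbonGraph V E) (hab : a ≠ b)
    (h : G.arc (a, i, s) = (b, j, t)) {A : Set E} (hA : a ∉ A ∨ b ∈ A) :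
    (G.handleSlide hab h).IsSpanningQuasiTree A ↔ G.IsSpanningQuasiTree A := by
  rw [handleSlide_feasible_iff, isSpanningQuasiTree_iff]
  have hB := G.boundarySetoid_le_connSetoid A
  have hT := slideSetoid_le_connSetoid G hab h A
  by_cases hb : b ∈ A
  · by_cases ha : a ∈ A
    · have hS := setoids_le_iff (i := i) (s := s) (j := j) (t := t) (α := true)
        (β := true) G hab A (by simp [ha]) (by simp [hb])
      simp [forall_fin_four_iff, edgePairs, slidePerm_x hab, slidePerm_u hab, slidePerm_y hab,
        slidePerm_v hab, slidePerm_far_a hab, slidePerm_far_b hab] at hS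
      -- The contracted paths differ before and after the slide, but the resulting three pairs are
      -- the same.
      rw [connSetoid_le_iff G h A hT
          ![(a, i, !s), (a, !i, s), (b, j, !t)] ![(a, !i, !s), (b, !j, t), (b, !j, !t)]
          (a, i, !s) (a, !i, !s) (b, !j, t) (a, !i, s) (b, j, !t) (b, !j, !t)
          (fun S => by grind) (fun S => by simp [setoid_comm S (b, !j, t)]) (by simp [hab, hab.symm]),
        connSetoid_le_iff G h A hB
          ![(a, i, !s), (a, !i, s), (b, j, !t)] ![(a, !i, !s), (b, !j, t), (b, !j, !t)]
          (a, !i, s) (b, !j, t) (a, i, !s) (a, !i, !s) (b, j, !t) (b, !j, !t)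
          (fun S => by rw [(hS S).1, setoid_comm S (a, !i, s)]; tauto) (fun S => by simp; tauto)
          (by simp [hab, hab.symm])]
    · have hS := setoids_le_iff (i := i) (s := s) (j := j) (t := t) (α := false)
        (β := true) G hab A (by simp [ha]) (by simp [hb])
      simp [forall_fin_four_iff, edgePairs, slidePerm_x hab, slidePerm_u hab, slidePerm_y hab,
        slidePerm_v hab, slidePerm_far_a hab, slidePerm_far_b hab] at hS
      -- Here `slidePerm` merely exchanges the near end of `a` with the side `t` of `b`, so the same
      -- four pairs are joined and nothing need be contracted.
      rw [le_antisymm ((hS _).2.2 ?_) ((hS _).1.2 ?_)]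
      · obtain ⟨h0, h1, h2, h3, h4⟩ := (hS _).1.1 le_rfl
        exact ⟨h0, h3, h2, h1, h4⟩
      · obtain ⟨h0, h1, h2, h3, h4⟩ := (hS _).2.1 le_rfl
        exact ⟨h0, h3, h2, h1, h4⟩
  · have ha : a ∉ A := by tauto
    have hS := setoids_le_iff (i := i) (s := s) (j := j) (t := t) (α := false)
        (β := false) G hab A (by simp [ha]) (by simp [hb])
    simp [forall_fin_four_iff, edgePairs, slidePerm_x hab, slidePerm_u hab, slidePerm_y hab,
        slidePerm_v hab, slidePerm_far_a hab, slidePerm_far_b hab] at hS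
    rw [connSetoid_le_iff G h A hT
        ![(a, i, !s), (a, !i, !s), (b, !j, t)] ![(b, j, !t), (a, !i, s), (b, !j, !t)]
        (b, !j, !t) (b, !j, t) (a, !i, !s) (a, !i, s) (a, i, !s) (b, j, !t)
        (fun S => by rw [(hS S).2, setoid_comm S (b, !j, !t)]; tauto)
        (fun S => by simp [setoid_comm S (b, !j, !t)]; tauto) (by simp [hab, hab.symm]),
      connSetoid_le_iff G h A hB
        ![(a, i, !s), (a, !i, !s), (b, !j, t)] ![(b, j, !t), (a, !i, s), (b, !j, !t)]
        (a, i, !s) (b, j, !t) (a, !i, !s) (a, !i, s) (b, !j, t) (b, !j, !t)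
        (fun S => by rw [(hS S).1]; tauto) (fun S => by simp) (by simp [hab, hab.symm])]

/-! ### The sets containing `a` but not `b` -/

/-- The corners of `a` and `b` that do not lie on the arc of the slide. -/
def farCorners (a b : E) (i s j t : Bool) : Fin 3 ⊕ Fin 3 → Corner E :=
  Sum.elim ![(a, i, !s), (a, !i, s), (b, !j, !t)] ![(a, !i, !s), (b, j, !t), (b, !j, t)]

lemma farCorners_injective (hab : a ≠ b) : (farCorners a b i s j t).Injective := by
  rintro (k | k) (l | l) <;> fin_cases k <;> fin_cases l <;>
    simp [farCorners, hab, hab.symm]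

lemma mem_range_farCorners (hab : a ≠ b) (c : Corner E) :
    c ∈ Set.range (farCorners a b i s j t) ↔
      (c.1 = a ∨ c.1 = b) ∧ ¬ (c = (a, i, s) ∨ c = (b, j, t)) := by
  constructor
  · rintro ⟨k | k, rfl⟩ <;> fin_cases k <;> simp [farCorners, hab, hab.symm]
  · rintro ⟨hc, hn⟩
    rcases corner_cases i s j t hc with (h | h | h | h) | (h | h | h | h)
    exacts [⟨.inl 0, h.symm⟩, (hn (.inl h)).elim, ⟨.inr 0, h.symm⟩, ⟨.inl 1, h.symm⟩,
      (hn (.inr h)).elim, ⟨.inr 2, h.symm⟩, ⟨.inr 1, h.symm⟩, ⟨.inl 2, h.symm⟩]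

/-- The fixed points of `restStep` are the corners of `a` and `b`, so `exists_partner` applies; the
arc of the slide is a class by itself and takes no partner from the other six. -/
lemma pairsUp_farCorners [Finite E] (G : RibbonGraph V E) (hab : a ≠ b)
    (h : G.arc (a, i, s) = (b, j, t)) (A : Set E) :
    PairsUp (G.restSetoid a b A) (Set.range (farCorners a b i s j t)) := by
  intro c hc
  rw [mem_range_farCorners hab] at hc
  obtain ⟨d, hdc, hd, hcd, hu⟩ := exists_partner G.arc_involutive G.arc_ne
    (restStep_involutive (a := a) (b := b) (A := A)) (restStep_eq_self_iff.2 hc.1)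
  have hu' : ∀ e ∈ Set.range (farCorners a b i s j t), G.restSetoid a b A c e → e = c ∨ e = d :=
    fun e he => hu e (restStep_eq_self_iff.2 ((mem_range_farCorners hab e).1 he).1)
  refine ⟨d, (mem_range_farCorners hab d).2 ⟨restStep_eq_self_iff.1 hd, fun hd' => ?_⟩,
    hdc, hcd, hu'⟩
  exact hc.2 ((restSetoid_iff G h A c d hcd).2 hd')

/-- If `a` is in `A` and `b` is not, then the three spanning ribbon subgraphs that `(V, A)` gives
before the slide, after the slide, and by exchanging `a` for `b` before the slide, join the pieces
of boundary outside of `a` and `b` in three ways; an even number of them give spanning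
quasi-trees. -/
lemma handleSlide_feasible_iff_xor [Finite E] (G : RibbonGraph V E) (hab : a ≠ b)
    (h : G.arc (a, i, s) = (b, j, t)) {A : Set E} (ha : a ∈ A) (hb : b ∉ A) :
    (G.handleSlide hab h).IsSpanningQuasiTree A ↔
      Xor (G.IsSpanningQuasiTree A) (G.IsSpanningQuasiTree (A \ {a} ∪ {b})) := by
  rw [handleSlide_feasible_iff, isSpanningQuasiTree_iff, isSpanningQuasiTree_iff]
  set B := A \ {a} ∪ {b} with hB
  have haB : a ∉ B := by simp [hB, hab]
  have hbB : b ∈ B := by simp [hB]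
  have hAB : G.restSetoid a b B = G.restSetoid a b A := by
    rw [restSetoid, restSetoid, restStep_congr]
    intro e h1 h2
    simp [hB, h1, h2]
  set R := G.restSetoid a b A with hR
  have hSA := setoids_le_iff (i := i) (s := s) (j := j) (t := t) (α := true)
    (β := false) G hab A (by simp [ha]) (by simp [hb])
  have hSB := setoids_le_iff (i := i) (s := s) (j := j) (t := t) (α := false)
    (β := true) G hab B (by simp [haB]) (by simp [hbB])
  simp [forall_fin_four_iff, edgePairs, slidePerm_x hab, slidePerm_u hab, slidePerm_y hab,
    slidePerm_v hab, slidePerm_far_a hab, slidePerm_far_b hab] at hSA hSB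
  -- The corners are ordered so that the three contracted matchings become the shifts of `q` by `0`,
  -- `1` and `2`.
  obtain ⟨p, hp⟩ : ∃ p : Fin 3 → Corner E, p = ![(a, i, !s), (a, !i, s), (b, !j, !t)] := ⟨_, rfl⟩
  obtain ⟨q, hq⟩ : ∃ q : Fin 3 → Corner E, q = ![(a, !i, !s), (b, j, !t), (b, !j, t)] := ⟨_, rfl⟩
  have hfar : farCorners a b i s j t = Sum.elim p q := by rw [hp, hq]; rfl
  have h0 := connSetoid_le_iff G h A (G.boundarySetoid_le_connSetoid A) p q
      (a, !i, s) (b, j, !t) (a, i, !s) (a, !i, !s) (b, !j, t) (b, !j, !t)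
      (fun S => by rw [(hSA S).1, setoid_comm S (a, !i, s)]; tauto)
      (fun S => by simp [hp, hq, setoid_comm S (b, !j, !t)]; tauto) (by simp [hab, hab.symm])
  have h1 := connSetoid_le_iff G h A (slideSetoid_le_connSetoid G hab h A) p (fun i => q (i + 1))
      (b, !j, !t) (a, !i, !s) (a, i, !s) (b, j, !t) (a, !i, s) (b, !j, t)
      (fun S => by rw [(hSA S).2, setoid_comm S (b, !j, !t), setoid_comm S (a, !i, s)]; tauto)
      (fun S => by simp [hp, hq]; tauto) (by simp [hab, hab.symm])
  have h2 := connSetoid_le_iff G h B (G.boundarySetoid_le_connSetoid B) p (fun i => q (i + 2))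
      (a, i, !s) (b, !j, t) (a, !i, s) (a, !i, !s) (b, !j, !t) (b, j, !t)
      (fun S => by
        rw [(hSB S).1, setoid_comm S (a, !i, s), setoid_comm S (b, !j, !t)]; tauto)
      (fun S => by simp [hp, hq]) (by simp [hab, hab.symm])
  rw [hAB] at h2
  have hd : (Sum.elim p q).Injective := hfar ▸ farCorners_injective hab
  have hP : Set.range (farCorners a b i s j t) = Set.range p ∪ Set.range q := by
    rw [hfar, Set.Sum.elim_range]
  have hpair : PairsUp R (Set.range p ∪ Set.range q) := hP ▸ pairsUp_farCorners G hab h A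
  rw [h0, h1, h2]
  refine hpair.le_joinPairs_iff_xor hd fun c hc => ?_
  have hconn : ∀ c : Corner E, c.1 = a ∨ c.1 = b → G.connSetoid (a, i, s) c := by
    rintro ⟨e, k⟩ (he | he) <;> obtain rfl : e = _ := he
    · exact G.connSetoid_same_edge _ _ _
    · exact G.connSetoid.trans (h ▸ G.connSetoid_arc (a, i, s)) (G.connSetoid_same_edge _ _ _)
  have hp0 : p 0 ∈ Set.range p ∪ Set.range q := .inl ⟨0, rfl⟩
  rw [← hP, mem_range_farCorners hab] at hc hp0
  exact ⟨G.connSetoid.trans (G.connSetoid.symm (hconn _ hp0.1)) (hconn _ hc.1),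
    iff_of_false hp0.2 hc.2⟩

end slide
end RibbonGraph

/-! ### Comparison with the slide of set systems -/

theorem theoremt {V E : Type*} [Finite E] (G : RibbonGraph V E) (a b : E) (hab : a ≠ b)
    (i s j t : Bool) (h : G.arc (a, i, s) = (b, j, t)) :
    (G.handleSlide hab h).deltaMatroid = G.deltaMatroid.handleSlide a b := by
  ext A
  change (G.handleSlide hab h).IsSpanningQuasiTree A ↔ A ∈ {A | G.IsSpanningQuasiTree A} ∆
    {Y | ∃ X : Set E, X ⊆ {a, b}ᶜ ∧ G.IsSpanningQuasiTree (X ∪ {b}) ∧ Y = X ∪ {a}}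
  -- The set `X` is determined by `A`: it must be `A \ {a}`.
  have hslide : (∃ X : Set E, X ⊆ {a, b}ᶜ ∧ G.IsSpanningQuasiTree (X ∪ {b}) ∧ A = X ∪ {a}) ↔
      a ∈ A ∧ b ∉ A ∧ G.IsSpanningQuasiTree (A \ {a} ∪ {b}) := by
    constructor
    · rintro ⟨X, hX, hF, rfl⟩
      have haX : a ∉ X := fun ha => hX ha (by simp)
      have hbX : b ∉ X := fun hb => hX hb (by simp)
      have : (X ∪ {a}) \ {a} = X := by simp [haX]
      exact ⟨by simp, by simp [hbX, hab.symm], by rwa [this]⟩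
    · rintro ⟨ha, hb, hF⟩
      refine ⟨A \ {a}, ?_, hF, by simp [ha]⟩
      rintro e ⟨he, hea⟩ (rfl | rfl)
      exacts [hea rfl, hb he]
  rw [Set.mem_symmDiff, Set.mem_ofPred_eq, Set.mem_ofPred_eq, hslide]
  by_cases hA : a ∉ A ∨ b ∈ A
  · rw [G.handleSlide_feasible_iff_of_notMem_or_mem hab h hA]
    tauto
  · push Not at hA
    rw [G.handleSlide_feasible_iff_xor hab h hA.1 hA.2, Xor]
    tauto
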